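/- For every integer $n\ge 2$ and every $\varepsilon>0$ there is a constant $C(n,\varepsilon)<\infty$ such that the following holds. Let $\mathbb{H}^n$ be the $n$-dimensional hyperbolic space of constant curvature $-1$, with hyperbolic distance $d_H$ and hyperbolic volume $\mathrm{Vol}$. For a set $A\subset\mathbb{H}^n$ let $A_\varepsilon=\bigcup_{x\in A}\{y\in\mathbb{H}^n : d_H(x,y)<\varepsilon\}$, and let $\mathrm{Conv}(A_\varepsilon)$ be its hyperbolic convex hull, i.e. the smallest set containing $A_\varepsilon$ that contains the geodesic segment between any two of its points. Then for every measurable set $A\subset\mathbb{H}^n$, $$\mathrm{Vol}(\mathrm{Conv}(A_\varepsilon))\le C(n,\varepsilon)\,\mathrm{Vol}(A_\varepsilon),$$ and the inequality is strict, $$\mathrm{Vol}(\mathrm{Conv}(A_\varepsilon))< C(n,\varepsilon)\,\mathrm{Vol}(A_\varepsilon),$$ whenever $A\neq\emptyset$ and $\mathrm{Vol}(A_\varepsilon)<\infty$. -/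

import Mathlib

open MeasureTheory
open scoped NNReal ENNReal

/-- The underlying space of the Klein model of hyperbolic `n`-space: the open Euclidean unit
ball of `ℝⁿ`. -/
abbrev KleinBall (n : ℕ) : Type :=
  {x : EuclideanSpace ℝ (Fin n) // ‖x‖ < 1}

namespace KleinBall

/-- The hyperbolic distance (curvature `-1`) in the Klein model:
`cosh d(x, y) = (1 - ⟨x, y⟩) / √((1 - |x|²) (1 - |y|²))`. (This is not the Euclidean distance
`dist x y` of the ball.) -/
noncomputable def hdist {n : ℕ} (x y : KleinBall n) : ℝ :=
  Real.arcosh ((1 - inner ℝ x.1 y.1) / √((1 - ‖x.1‖ ^ 2) * (1 - ‖y.1‖ ^ 2)))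

/-- The open hyperbolic ball of radius `r` around `x`. -/
def hball {n : ℕ} (x : KleinBall n) (r : ℝ) : Set (KleinBall n) :=
  {y | hdist x y < r}

/-- The `ε`-extension of `A`: the union of the hyperbolic `ε`-balls centred at points of `A`. -/
def extension {n : ℕ} (ε : ℝ) (A : Set (KleinBall n)) : Set (KleinBall n) :=
  ⋃ x ∈ A, hball x ε

/-- The geodesic segment between `x` and `y`: the points at which equality holds in the triangle
inequality of the hyperbolic distance. -/
def geodesicSegment {n : ℕ} (x y : KleinBall n) : Set (KleinBall n) :=
  {z | hdist x z + hdist z y = hdist x y}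

/-- A set is (hyperbolically) convex if it contains the geodesic segment between any two of its
points. -/
def IsConvex {n : ℕ} (S : Set (KleinBall n)) : Prop :=
  ∀ x ∈ S, ∀ y ∈ S, geodesicSegment x y ⊆ S

/-- The hyperbolic convex hull of `A`: the intersection of all convex sets that contain `A`. -/
def hull {n : ℕ} (A : Set (KleinBall n)) : Set (KleinBall n) :=
  ⋂₀ {S | A ⊆ S ∧ IsConvex S}

/-- The hyperbolic volume in the Klein model: the measure with density
`(1 - |x|²) ^ (-(n + 1) / 2)` with respect to Lebesgue measure on the unit ball. -/
noncomputable def hvol (n : ℕ) : Measure (KleinBall n) :=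
  (Measure.comap Subtype.val (volume : Measure (EuclideanSpace ℝ (Fin n)))).withDensity
    fun x => ENNReal.ofReal (1 / (1 - ‖x.1‖ ^ 2) ^ (((n : ℝ) + 1) / 2))

end KleinBall

/-! In the Klein model geodesics are Euclidean chords, so the hyperbolic hull of `A_ε` lies in any
Euclidean convex set containing `A_ε`. If `Vol(A_ε)` is finite, a maximal `ε`-separated subset of
`A` has at most `Vol(A_ε) / v` points, where `v` bounds the volume of `ε/2`-balls from below
(`exists_pos_le_hvol_hball`), and the `2ε`-balls around it cover `A_ε`. Each such ball lies in the
hull of the origin and boundedly many points of the unit sphere (`exists_ideal_hull_hball`). It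
remains to see that the hull of the origin and `N` ideal points has volume `O(N)`
(`exists_hvol_convexHull_le`).

For a point `p` of that hull with direction `θ`, let `y₁` be the ideal point nearest to `θ`, at
distance `r`. If no ideal point has distance between `r/2` and `R` from `y₁`, then `1 - ‖p‖` is at
least a constant times `r R` (`depth_of_gap`). Hence `p` lies in a cusp region determined by `y₁`
and the scale `R`. There are quadratically many pairs of ideal points, but a farthest-point ordering
supplies `O(N)` pairs (point, scale) that approximate them all (`exists_linear_scale_pairs`). In
dimension at least two each cusp region has volume bounded independently of its scale
(`exists_hvol_cusp_le`). -/

namespace KleinBall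

/-! ### Hyperbolic distance and geodesics through the Minkowski form. -/

section Minkowski

variable {E : Type*} [NormedAddCommGroup E] [InnerProductSpace ℝ E]

/-- A vector `(w₀, w)` of Minkowski space that is orthogonal to the timelike vector `(1, z)` is
spacelike, and it is null only if it vanishes. -/
theorem sq_le_norm_sq_of_eq_inner {w z : E} {w₀ : ℝ} (hz : ‖z‖ < 1) (h : w₀ = inner ℝ w z) :
    w₀ ^ 2 ≤ ‖w‖ ^ 2 ∧ (w₀ ^ 2 = ‖w‖ ^ 2 → w = 0) := by
  have h1 : w₀ ^ 2 ≤ ‖w‖ ^ 2 * ‖z‖ ^ 2 := by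
    rw [← mul_pow, ← sq_abs, h]
    exact pow_le_pow_left₀ (abs_nonneg _) (abs_real_inner_le_norm w z) 2
  have h2 : ‖z‖ ^ 2 < 1 := by nlinarith [norm_nonneg z]
  refine ⟨by nlinarith [sq_nonneg ‖w‖], fun h3 => ?_⟩
  have : ‖w‖ ^ 2 = 0 := by nlinarith [sq_nonneg ‖w‖]
  simpa using this

/-- `hS` says that `P(1,x) + Q(1,y) - S(1,z)` is Minkowski-orthogonal to the timelike vector
`(1,z)`. It is therefore spacelike or zero, and expanding its square gives the claim. -/
theorem minkowski_combination {x y z : E} (hz : ‖z‖ < 1) {P Q S : ℝ}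
    (hS : S * (1 - ‖z‖ ^ 2) = P * (1 - inner ℝ x z) + Q * (1 - inner ℝ y z)) :
    P ^ 2 * (1 - ‖x‖ ^ 2) + Q ^ 2 * (1 - ‖y‖ ^ 2) + 2 * P * Q * (1 - inner ℝ x y) ≤
        S ^ 2 * (1 - ‖z‖ ^ 2) ∧
      (P ^ 2 * (1 - ‖x‖ ^ 2) + Q ^ 2 * (1 - ‖y‖ ^ 2) + 2 * P * Q * (1 - inner ℝ x y) =
        S ^ 2 * (1 - ‖z‖ ^ 2) → P • x + Q • y = S • z ∧ P + Q = S) := by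
  have hw : P + Q - S = inner ℝ (P • x + Q • y - S • z) z := by
    simp only [inner_sub_left, inner_add_left, real_inner_smul_left, real_inner_self_eq_norm_sq]
    linarith
  have hn : ‖P • x + Q • y - S • z‖ ^ 2 = P ^ 2 * ‖x‖ ^ 2 + Q ^ 2 * ‖y‖ ^ 2 + S ^ 2 * ‖z‖ ^ 2
      + 2 * P * Q * inner ℝ x y - 2 * P * S * inner ℝ x z - 2 * Q * S * inner ℝ y z := by
    rw [← real_inner_self_eq_norm_sq]
    simp only [inner_sub_left, inner_add_left, real_inner_smul_left, inner_sub_right,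
      inner_add_right, real_inner_smul_right, real_inner_self_eq_norm_sq, norm_smul, mul_pow,
      Real.norm_eq_abs, sq_abs]
    rw [real_inner_comm x y, real_inner_comm x z, real_inner_comm y z]
    ring
  obtain ⟨h1, h2⟩ := sq_le_norm_sq_of_eq_inner hz hw
  have hS' := congrArg (2 * S * ·) hS
  rw [hn] at h1 h2
  refine ⟨by linarith, fun h => ?_⟩
  have h3 := h2 (by linarith)
  rw [h3, inner_zero_left] at hw
  exact ⟨sub_eq_zero.1 h3, by linarith⟩

end Minkowski

variable {n : ℕ}

theorem one_sub_norm_sq_pos (x : KleinBall n) : 0 < 1 - ‖x.1‖ ^ 2 := by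
  nlinarith [x.2, norm_nonneg x.1]

/-- The hyperbolic cosine of the distance. -/
noncomputable def hcosh (x y : KleinBall n) : ℝ :=
  (1 - inner ℝ x.1 y.1) / √((1 - ‖x.1‖ ^ 2) * (1 - ‖y.1‖ ^ 2))

theorem one_le_hcosh (x y : KleinBall n) : 1 ≤ hcosh x y := by
  have h := real_inner_le_norm x.1 y.1
  have h1 := x.2
  have h2 := y.2
  have hx := one_sub_norm_sq_pos x
  have hy := one_sub_norm_sq_pos y
  rw [hcosh, le_div_iff₀ (by positivity), one_mul]
  have h3 : 0 < 1 - ‖x.1‖ * ‖y.1‖ := by nlinarith [norm_nonneg x.1, norm_nonneg y.1]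
  refine Real.sqrt_le_iff.2 ⟨by linarith, ?_⟩
  nlinarith [sq_nonneg (‖x.1‖ - ‖y.1‖)]

theorem cosh_hdist (x y : KleinBall n) : Real.cosh (hdist x y) = hcosh x y :=
  Real.cosh_arcosh (one_le_hcosh x y)

theorem hdist_nonneg (x y : KleinBall n) : 0 ≤ hdist x y := Real.arcosh_nonneg (one_le_hcosh x y)

theorem hcosh_comm (x y : KleinBall n) : hcosh x y = hcosh y x := by
  rw [hcosh, hcosh, real_inner_comm, mul_comm]

theorem hdist_comm (x y : KleinBall n) : hdist x y = hdist y x :=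
  congrArg Real.arcosh (hcosh_comm x y)

theorem hdist_self (x : KleinBall n) : hdist x x = 0 := by
  have hx := one_sub_norm_sq_pos x
  refine (Real.arcosh_eq_zero_iff (one_le_hcosh x x)).2 ?_
  rw [hcosh, Real.sqrt_mul_self hx.le, real_inner_self_eq_norm_sq, div_self hx.ne']

theorem hdist_lt_iff {x y : KleinBall n} {r : ℝ} (hr : 0 ≤ r) :
    hdist x y < r ↔ hcosh x y < Real.cosh r := by
  rw [← cosh_hdist, Real.cosh_lt_cosh, abs_of_nonneg (hdist_nonneg x y), abs_of_nonneg hr]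

theorem one_sub_inner_eq (x y : KleinBall n) :
    1 - inner ℝ x.1 y.1 = hcosh x y * (√(1 - ‖x.1‖ ^ 2) * √(1 - ‖y.1‖ ^ 2)) := by
  have hx := one_sub_norm_sq_pos x
  have hy := one_sub_norm_sq_pos y
  rw [hcosh, Real.sqrt_mul hx.le, div_mul_cancel₀]
  positivity

/-- The Gram form of three points of hyperbolic space, projected orthogonally to the third. -/
theorem hcosh_combination (x y z : KleinBall n) (p q : ℝ) :
    0 ≤ p ^ 2 * (hcosh x z ^ 2 - 1) + q ^ 2 * (hcosh z y ^ 2 - 1)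
        + 2 * p * q * (hcosh x z * hcosh z y - hcosh x y) ∧
      (p ^ 2 * (hcosh x z ^ 2 - 1) + q ^ 2 * (hcosh z y ^ 2 - 1)
        + 2 * p * q * (hcosh x z * hcosh z y - hcosh x y) = 0 →
        (p / √(1 - ‖x.1‖ ^ 2)) • x.1 + (q / √(1 - ‖y.1‖ ^ 2)) • y.1 =
          ((p * hcosh x z + q * hcosh z y) / √(1 - ‖z.1‖ ^ 2)) • z.1 ∧
        p / √(1 - ‖x.1‖ ^ 2) + q / √(1 - ‖y.1‖ ^ 2) =
          (p * hcosh x z + q * hcosh z y) / √(1 - ‖z.1‖ ^ 2)) := by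
  have hx := Real.sqrt_pos.2 (one_sub_norm_sq_pos x)
  have hy := Real.sqrt_pos.2 (one_sub_norm_sq_pos y)
  have hz := Real.sqrt_pos.2 (one_sub_norm_sq_pos z)
  have ex := Real.sq_sqrt (one_sub_norm_sq_pos x).le
  have ey := Real.sq_sqrt (one_sub_norm_sq_pos y).le
  have ez := Real.sq_sqrt (one_sub_norm_sq_pos z).le
  have ixz := one_sub_inner_eq x z
  have iyz := one_sub_inner_eq y z
  have ixy := one_sub_inner_eq x y
  rw [hcosh_comm y z] at iyz
  obtain ⟨h1, h2⟩ := minkowski_combination (x := x.1) (y := y.1) (z := z.1) z.2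
    (P := p / √(1 - ‖x.1‖ ^ 2)) (Q := q / √(1 - ‖y.1‖ ^ 2))
    (S := (p * hcosh x z + q * hcosh z y) / √(1 - ‖z.1‖ ^ 2)) (by
      rw [ixz, iyz, ← ez, Real.sqrt_sq hz.le]; field_simp)
  rw [ixy, ← ex, ← ey, ← ez] at h1 h2
  simp only [Real.sqrt_sq hx.le, Real.sqrt_sq hy.le, Real.sqrt_sq hz.le] at h1 h2
  have e1 : (p / √(1 - ‖x.1‖ ^ 2)) ^ 2 * √(1 - ‖x.1‖ ^ 2) ^ 2 = p ^ 2 := by field_simp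
  have e2 : (q / √(1 - ‖y.1‖ ^ 2)) ^ 2 * √(1 - ‖y.1‖ ^ 2) ^ 2 = q ^ 2 := by field_simp
  have e3 : ((p * hcosh x z + q * hcosh z y) / √(1 - ‖z.1‖ ^ 2)) ^ 2 * √(1 - ‖z.1‖ ^ 2) ^ 2
    = (p * hcosh x z + q * hcosh z y) ^ 2 := by field_simp
  have e4 : 2 * (p / √(1 - ‖x.1‖ ^ 2)) * (q / √(1 - ‖y.1‖ ^ 2)) *
    (hcosh x y * (√(1 - ‖x.1‖ ^ 2) * √(1 - ‖y.1‖ ^ 2))) = 2 * p * q * hcosh x y := by field_simp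
  rw [e1, e2, e3, e4] at h1 h2
  exact ⟨by linarith, fun h => h2 (by linarith)⟩

/-- The Gram form is nonnegative, so its discriminant is nonpositive; with `cosh² = 1 + sinh²` this
bounds `cosh d(x,y)` by `cosh (d(x,z) + d(z,y))`. -/
theorem hdist_triangle (x z y : KleinBall n) : hdist x y ≤ hdist x z + hdist z y := by
  have ha := hdist_nonneg x z
  have hb := hdist_nonneg z y
  by_contra! hlt
  have h1 : Real.cosh (hdist x z + hdist z y) < Real.cosh (hdist x y) := by
    rw [Real.cosh_lt_cosh, abs_of_nonneg (by positivity), abs_of_nonneg (hdist_nonneg x y)]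
    exact hlt
  have h2 : discrim (hcosh x z ^ 2 - 1) (2 * (hcosh x z * hcosh z y - hcosh x y))
      (hcosh z y ^ 2 - 1) ≤ 0 := by
    refine discrim_le_zero fun t => ?_
    have := (hcosh_combination x y z t 1).1
    nlinarith
  rw [discrim, ← cosh_hdist x z, ← cosh_hdist z y, ← cosh_hdist x y] at h2
  rw [Real.cosh_add] at h1
  have s1 := Real.cosh_sq (hdist x z)
  have s2 := Real.cosh_sq (hdist z y)
  rw [s1, s2] at h2
  have s3 : 0 ≤ Real.sinh (hdist x z) * Real.sinh (hdist z y) :=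
    mul_nonneg (Real.sinh_nonneg_iff.2 ha) (Real.sinh_nonneg_iff.2 hb)
  nlinarith

/-- Equality in the triangle inequality makes the Gram form vanish at `(sinh d(z,y), sinh d(x,z))`;
the null case then exhibits `z` as a combination of `x` and `y` with nonnegative weights. If both
distances vanish these weights are zero, and `(1, 0)` is used instead. -/
theorem geodesicSegment_subset_segment {x y z : KleinBall n} (h : z ∈ geodesicSegment x y) :
    z.1 ∈ segment ℝ x.1 y.1 := by
  have hx := Real.sqrt_pos.2 (one_sub_norm_sq_pos x)
  have hy := Real.sqrt_pos.2 (one_sub_norm_sq_pos y)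
  have hz := Real.sqrt_pos.2 (one_sub_norm_sq_pos z)
  have ha := hdist_nonneg x z
  have hb := hdist_nonneg z y
  have h : hdist x z + hdist z y = hdist x y := h
  rcases (add_nonneg ha hb).eq_or_lt with h0 | h0
  · have h1 : hcosh x z = 1 :=
      (Real.arcosh_eq_zero_iff (one_le_hcosh x z)).1 (show hdist x z = 0 by linarith)
    obtain ⟨h2, h3⟩ := (hcosh_combination x y z 1 0).2 (by rw [h1]; ring)
    simp only [h1, zero_div, zero_smul, add_zero, zero_mul, one_mul] at h2 h3
    rw [h3] at h2
    have : x.1 = z.1 := smul_right_injective _ (one_div_pos.2 hz).ne' h2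
    rw [← this]
    exact left_mem_segment ℝ _ _
  · have c1 := cosh_hdist x z
    have c2 := cosh_hdist z y
    have c3 := cosh_hdist x y
    rw [← h, Real.cosh_add] at c3
    have s1 := Real.cosh_sq (hdist x z)
    have s2 := Real.cosh_sq (hdist z y)
    obtain ⟨h2, h3⟩ := (hcosh_combination x y z (Real.sinh (hdist z y))
      (Real.sinh (hdist x z))).2 (by rw [← c1, ← c2, ← c3, s1, s2]; ring)
    have hs : Real.sinh (hdist z y) * hcosh x z + Real.sinh (hdist x z) * hcosh z y =
        Real.sinh (hdist x z + hdist z y) := by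
      rw [Real.sinh_add, c1, c2]; ring
    rw [hs] at h2 h3
    have hs0 := Real.sinh_pos_iff.2 h0
    have hS : 0 < Real.sinh (hdist x z + hdist z y) / √(1 - ‖z.1‖ ^ 2) := by positivity
    have hP : 0 ≤ Real.sinh (hdist z y) / √(1 - ‖x.1‖ ^ 2) :=
      div_nonneg (Real.sinh_nonneg_iff.2 hb) hx.le
    have hQ : 0 ≤ Real.sinh (hdist x z) / √(1 - ‖y.1‖ ^ 2) :=
      div_nonneg (Real.sinh_nonneg_iff.2 ha) hy.le
    generalize Real.sinh (hdist x z + hdist z y) / √(1 - ‖z.1‖ ^ 2) = S at *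
    generalize Real.sinh (hdist z y) / √(1 - ‖x.1‖ ^ 2) = P at *
    generalize Real.sinh (hdist x z) / √(1 - ‖y.1‖ ^ 2) = Q at *
    refine ⟨P / S, Q / S, by positivity, by positivity, by rw [← add_div, h3, div_self hS.ne'], ?_⟩
    rw [div_eq_inv_mul, div_eq_inv_mul, mul_smul, mul_smul, ← smul_add, h2, smul_smul,
      inv_mul_cancel₀ hS.ne', one_smul]

theorem isConvex_preimage {T : Set (EuclideanSpace ℝ (Fin n))} (hT : Convex ℝ T) :
    IsConvex {x : KleinBall n | x.1 ∈ T} :=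
  fun _ hx _ hy _ hz => hT.segment_subset hx hy (geodesicSegment_subset_segment hz)

theorem hull_subset_of_convex {A : Set (KleinBall n)} {T : Set (EuclideanSpace ℝ (Fin n))}
    (hT : Convex ℝ T) (hA : ∀ x ∈ A, x.1 ∈ T) : hull A ⊆ {x | x.1 ∈ T} :=
  Set.sInter_subset_of_mem ⟨hA, isConvex_preimage hT⟩

end KleinBall

/-! ### Hyperbolic volume and a lower bound for the volume of balls. -/

namespace KleinBall

variable {n : ℕ}

theorem measurableEmbedding_val :
    MeasurableEmbedding (Subtype.val : KleinBall n → EuclideanSpace ℝ (Fin n)) :=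
  MeasurableEmbedding.subtype_coe (isOpen_lt continuous_norm continuous_const).measurableSet

theorem hvol_preimage (T : Set (EuclideanSpace ℝ (Fin n))) (hT : MeasurableSet T) :
    hvol n {x | x.1 ∈ T} = ∫⁻ x in {x : KleinBall n | x.1 ∈ T},
      ENNReal.ofReal (1 / (1 - ‖x.1‖ ^ 2) ^ (((n : ℝ) + 1) / 2))
        ∂(Measure.comap Subtype.val (volume : Measure (EuclideanSpace ℝ (Fin n)))) := by
  rw [hvol, withDensity_apply]
  exact measurable_subtype_coe hT

theorem comap_preimage (T : Set (EuclideanSpace ℝ (Fin n))) :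
    Measure.comap Subtype.val (volume : Measure (EuclideanSpace ℝ (Fin n)))
      {x : KleinBall n | x.1 ∈ T} = volume (T ∩ Metric.ball 0 1) := by
  rw [measurableEmbedding_val.comap_apply]
  congr 1
  ext y
  simp only [Set.mem_image, Set.mem_ofPred_eq, Set.mem_inter_iff, mem_ball_zero_iff]
  exact ⟨fun ⟨x, h, e⟩ => e ▸ ⟨h, x.2⟩, fun h => ⟨⟨y, h.2⟩, h.1, rfl⟩⟩

theorem hvol_preimage_le {T : Set (EuclideanSpace ℝ (Fin n))} (hT : MeasurableSet T) {K : ℝ}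
    (hK : ∀ x ∈ T, ‖x‖ < 1 → 1 / (1 - ‖x‖ ^ 2) ^ (((n : ℝ) + 1) / 2) ≤ K) :
    hvol n {x | x.1 ∈ T} ≤ ENNReal.ofReal K * volume (T ∩ Metric.ball 0 1) := by
  rw [hvol_preimage T hT, ← comap_preimage, ← setLIntegral_const]
  exact setLIntegral_mono' (measurable_subtype_coe hT)
    fun x hx => ENNReal.ofReal_le_ofReal (hK x.1 hx x.2)

theorem le_hvol_preimage {T : Set (EuclideanSpace ℝ (Fin n))} (hT : MeasurableSet T) {K : ℝ}
    (hK : ∀ x ∈ T, ‖x‖ < 1 → K ≤ 1 / (1 - ‖x‖ ^ 2) ^ (((n : ℝ) + 1) / 2)) :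
    ENNReal.ofReal K * volume (T ∩ Metric.ball 0 1) ≤ hvol n {x | x.1 ∈ T} := by
  rw [hvol_preimage T hT, ← comap_preimage, ← setLIntegral_const]
  exact setLIntegral_mono' (measurable_subtype_coe hT)
    fun x hx => ENNReal.ofReal_le_ofReal (hK x.1 hx x.2)

theorem hdist_lt_of_sq_lt {x y : KleinBall n} {r : ℝ} (hr : 0 ≤ r)
    (h : (1 - inner ℝ x.1 y.1) ^ 2 <
      (1 + Real.sinh r ^ 2) * ((1 - ‖x.1‖ ^ 2) * (1 - ‖y.1‖ ^ 2))) : hdist x y < r := by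
  have hx := one_sub_norm_sq_pos x
  have hy := one_sub_norm_sq_pos y
  rw [hdist_lt_iff hr, hcosh, div_lt_iff₀ (by positivity)]
  refine lt_of_pow_lt_pow_left₀ 2 (mul_nonneg (Real.cosh_pos r).le (by positivity)) ?_
  rwa [mul_pow, Real.sq_sqrt (by positivity), Real.cosh_sq, add_comm (Real.sinh r ^ 2)]

/-- The volume of a box in the coordinates of an orthonormal basis. -/
theorem volume_box (b : OrthonormalBasis (Fin n) ℝ (EuclideanSpace ℝ (Fin n))) (l u : Fin n → ℝ) :
    MeasurableSet {y | ∀ i, b.repr y i ∈ Set.Icc (l i) (u i)} ∧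
    volume {y | ∀ i, b.repr y i ∈ Set.Icc (l i) (u i)} = ∏ i, ENNReal.ofReal (u i - l i) := by
  have h : MeasurePreserving (fun y => (b.repr y).ofLp) :=
    (PiLp.volume_preserving_ofLp (Fin n)).comp b.measurePreserving_repr
  have e : {y | ∀ i, b.repr y i ∈ Set.Icc (l i) (u i)} =
      (fun y => (b.repr y).ofLp) ⁻¹' Set.Icc l u := by
    ext y
    simp [Pi.le_def, forall_and]
  rw [e, h.measure_preimage measurableSet_Icc.nullMeasurableSet, Real.volume_Icc_pi]
  exact ⟨h.measurable measurableSet_Icc, rfl⟩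

theorem exists_orthonormalBasis_direction (x : EuclideanSpace ℝ (Fin (n + 1))) :
    ∃ b : OrthonormalBasis (Fin (n + 1)) ℝ (EuclideanSpace ℝ (Fin (n + 1))),
      x = ‖x‖ • b 0 := by
  obtain ⟨e, he, hx⟩ : ∃ e : EuclideanSpace ℝ (Fin (n + 1)), ‖e‖ = 1 ∧ x = ‖x‖ • e := by
    rcases eq_or_ne x 0 with rfl | hx
    · exact ⟨EuclideanSpace.single 0 1, by simp, by simp⟩
    · exact ⟨‖x‖⁻¹ • x, by simp [norm_smul, hx], by simp [smul_smul, hx]⟩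
  have hon : Orthonormal ℝ (({0} : Set (Fin (n + 1))).domRestrict fun _ => e) := by
    refine ⟨fun _ => he, fun i j hij => (hij ?_).elim⟩
    exact Subsingleton.elim i j
  obtain ⟨b, hb⟩ := hon.exists_orthonormalBasis_extension_of_card_eq (by simp)
  exact ⟨b, by rw [hb 0 rfl]; exact hx⟩

/-- Here `s` is a radial displacement and `W` the square of a transverse one. The identity `hid`
shows that the excess over `D (1 - ‖y‖²)` is `s² + D W ≤ 2c²D²`, while the term with `σ²` leaves
room for `9c²D²/2`. -/
theorem box_estimate {ρ D c σ s W : ℝ} (hρ : 0 ≤ ρ) (hρ1 : ρ < 1) (hD : D = 1 - ρ ^ 2)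
    (hc : 0 < c) (hc1 : c ≤ 1 / 8) (hcσ : c ≤ σ / 3) (hs : |s| ≤ c * D) (hW0 : 0 ≤ W)
    (hW : W ≤ c ^ 2 * D) :
    D / 2 ≤ 1 - ((ρ + s) ^ 2 + W) ∧ 1 - ((ρ + s) ^ 2 + W) ≤ 2 * D ∧
      (1 - ρ * (ρ + s)) ^ 2 < (1 + σ ^ 2) * (D * (1 - ((ρ + s) ^ 2 + W))) := by
  have hD0 : 0 < D := by nlinarith
  have hD1 : D ≤ 1 := by nlinarith
  obtain ⟨h1, h2⟩ := abs_le.1 hs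
  have hs2 : s ^ 2 ≤ c ^ 2 * D ^ 2 := by
    rw [← mul_pow, ← sq_abs s]
    exact pow_le_pow_left₀ (abs_nonneg s) hs 2
  have hc2 : c ^ 2 ≤ c / 8 := by nlinarith
  have hcD : c ^ 2 * D ≤ D / 64 := by nlinarith
  have hcD2 : c ^ 2 * D ^ 2 ≤ D / 64 := by nlinarith
  have hcD0 : 0 < c * D := by positivity
  have hρs : |ρ * s| ≤ c * D := by
    rw [abs_mul, abs_of_nonneg hρ]
    nlinarith [abs_nonneg s]
  obtain ⟨h3, h4⟩ := abs_le.1 hρs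
  have hcD3 : c * D ≤ D / 8 := by nlinarith
  have e : (1 : ℝ) - ((ρ + s) ^ 2 + W) = D - 2 * (ρ * s) - s ^ 2 - W := by rw [hD]; ring
  have hlow : D / 2 ≤ 1 - ((ρ + s) ^ 2 + W) := by rw [e]; linarith
  refine ⟨hlow, by rw [e]; nlinarith, ?_⟩
  have hid : (1 - ρ * (ρ + s)) ^ 2 = D * (1 - ((ρ + s) ^ 2 + W)) + (s ^ 2 + D * W) := by
    rw [hD]; ring
  have hσ : 9 * c ^ 2 ≤ σ ^ 2 := by nlinarith
  have hDW : D * W ≤ c ^ 2 * D ^ 2 := by nlinarith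
  have h5 : 9 * c ^ 2 * (D * (D / 2)) ≤ σ ^ 2 * (D * (1 - ((ρ + s) ^ 2 + W))) :=
    mul_le_mul hσ (mul_le_mul_of_nonneg_left hlow hD0.le) (by positivity) (by positivity)
  have h6 : 0 < c ^ 2 * D ^ 2 := by positivity
  rw [hid]
  nlinarith

theorem rpow_half_natCast_succ {a : ℝ} (ha : 0 ≤ a) (m : ℕ) :
    a ^ (((m : ℝ) + 1) / 2) = √a ^ (m + 1) := by
  rw [Real.rpow_div_two_eq_sqrt _ ha, ← Real.rpow_natCast]
  push_cast
  rfl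

/-- Hyperbolic balls of a given radius have volume bounded below. -/
theorem exists_pos_le_hvol_hball (hn : 1 ≤ n) {r : ℝ} (hr : 0 < r) :
    ∃ v : ℝ≥0, 0 < v ∧ ∀ x : KleinBall n, (v : ℝ≥0∞) ≤ hvol n (hball x r) := by
  obtain ⟨m, rfl⟩ : ∃ m, n = m + 1 := ⟨n - 1, by omega⟩
  set σ := Real.sinh r with hσ
  have hσ0 : 0 < σ := Real.sinh_pos_iff.2 hr
  set c := min (1 / 8) (σ / 3) with hc
  have hc0 : 0 < c := by positivity
  set N : ℝ := √((m : ℝ) + 1) with hN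
  have hN0 : 0 < N := by positivity
  refine ⟨Real.toNNReal (2 * c * (2 * c / N) ^ m / √2 ^ (m + 2)),
    Real.toNNReal_pos.2 (by positivity), fun x => ?_⟩
  obtain ⟨b, hb⟩ := exists_orthonormalBasis_direction x.1
  set ρ := ‖x.1‖ with hρ
  set D := 1 - ρ ^ 2 with hD
  have hD0 : 0 < D := one_sub_norm_sq_pos x
  have hsD : 0 < √D := Real.sqrt_pos.2 hD0
  -- The box has radial side of order `D` and transverse sides of order `√D`, so its Lebesgue volume
  -- is of order `√D ^ (m + 2)`, which cancels the density. The factor `N` keeps the sum of the `m`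
  -- transverse squares below `c²D`.
  let l : Fin (m + 1) → ℝ := Fin.cons (ρ - c * D) fun _ => -(c * √D / N)
  let u : Fin (m + 1) → ℝ := Fin.cons (ρ + c * D) fun _ => c * √D / N
  obtain ⟨hmeas, hvolT⟩ := volume_box b l u
  set T := {y | ∀ i, b.repr y i ∈ Set.Icc (l i) (u i)} with hT
  have key : ∀ y ∈ T, D / 2 ≤ 1 - ‖y‖ ^ 2 ∧ 1 - ‖y‖ ^ 2 ≤ 2 * D ∧
      (1 - inner ℝ x.1 y) ^ 2 < (1 + σ ^ 2) * (D * (1 - ‖y‖ ^ 2)) := by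
    intro y hy
    have h0 := hy 0
    have hW : ∀ i : Fin m, (b.repr y i.succ) ^ 2 ≤ c ^ 2 * D / (m + 1) := by
      intro i
      have h1 := hy i.succ
      simp only [l, u, Fin.cons_succ] at h1
      have h2 : |b.repr y i.succ| ≤ c * √D / N := abs_le.2 h1
      calc (b.repr y i.succ) ^ 2 = |b.repr y i.succ| ^ 2 := (sq_abs _).symm
        _ ≤ (c * √D / N) ^ 2 := pow_le_pow_left₀ (abs_nonneg _) h2 2
        _ = c ^ 2 * D / (m + 1) := by
          rw [div_pow, mul_pow, Real.sq_sqrt hD0.le, hN, Real.sq_sqrt (by positivity)]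
    have hnorm : ‖y‖ ^ 2 = (b.repr y 0) ^ 2 + ∑ i : Fin m, (b.repr y i.succ) ^ 2 := by
      rw [← b.repr.norm_map y, EuclideanSpace.real_norm_sq_eq, Fin.sum_univ_succ]
    have hsum : ∑ i : Fin m, (b.repr y i.succ) ^ 2 ≤ c ^ 2 * D := by
      calc ∑ i : Fin m, (b.repr y i.succ) ^ 2 ≤ ∑ i : Fin m, c ^ 2 * D / (m + 1) :=
            Finset.sum_le_sum fun i _ => hW i
        _ = c ^ 2 * D * (m / (m + 1)) := by simp; ring
        _ ≤ c ^ 2 * D * 1 := by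
          refine mul_le_mul_of_nonneg_left ?_ (by positivity)
          rw [div_le_one (by positivity)]
          linarith
        _ = c ^ 2 * D := mul_one _
    have hin : inner ℝ x.1 y = ρ * b.repr y 0 := by
      rw [hb, real_inner_smul_left, OrthonormalBasis.repr_apply_apply]
    simp only [l, u, Fin.cons_zero] at h0
    have := box_estimate (ρ := ρ) (D := D) (c := c) (σ := σ) (s := b.repr y 0 - ρ)
      (W := ∑ i : Fin m, (b.repr y i.succ) ^ 2) (norm_nonneg _) x.2 rfl hc0 (min_le_left _ _)
      (min_le_right _ _) (abs_le.2 ⟨by linarith [h0.1], by linarith [h0.2]⟩)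
      (Finset.sum_nonneg fun i _ => sq_nonneg _) hsum
    rw [add_sub_cancel] at this
    rw [hnorm, hin]
    exact this
  have hTball : T ∩ Metric.ball 0 1 = T := by
    refine Set.inter_eq_left.2 fun y hy => ?_
    have := (key y hy).1
    rw [mem_ball_zero_iff]
    nlinarith [norm_nonneg y]
  have hsub : {y : KleinBall (m + 1) | y.1 ∈ T} ⊆ hball x r :=
    fun y hy => hdist_lt_of_sq_lt hr.le (key y.1 hy).2.2
  refine le_trans ?_ (measure_mono hsub)
  refine le_trans ?_ (le_hvol_preimage (K := 1 / √(2 * D) ^ (m + 2)) hmeas fun y hy hy1 => ?_)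
  · rw [hTball, hvolT, Fin.prod_univ_succ]
    simp only [l, u, Fin.cons_zero, Fin.cons_succ, Finset.prod_const, Finset.card_univ,
      Fintype.card_fin]
    rw [← ENNReal.ofReal_pow (by rw [sub_neg_eq_add]; positivity),
      ← ENNReal.ofReal_mul (by ring_nf; positivity), ← ENNReal.ofReal_mul (by positivity)]
    refine ENNReal.ofReal_le_ofReal (le_of_eq ?_)
    have e1 : ρ + c * D - (ρ - c * D) = 2 * c * √D ^ 2 := by rw [Real.sq_sqrt hD0.le]; ring
    have e2 : c * √D / N - -(c * √D / N) = 2 * c / N * √D := by ring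
    rw [e1, e2, Real.sqrt_mul (by norm_num), mul_pow, mul_pow, pow_add (√D)]
    field_simp
  · have h1 := (key y hy).1
    rw [rpow_half_natCast_succ (by linarith)]
    have h2 : 0 < √(1 - ‖y‖ ^ 2) := Real.sqrt_pos.2 (by linarith)
    exact one_div_le_one_div_of_le (by positivity)
      (pow_le_pow_left₀ h2.le (Real.sqrt_le_sqrt (key y hy).2.1) _)

end KleinBall

/-! ### Separated sets, packing and linearly many scales. -/

/-- If the families of pairwise distant points of `S` have bounded cardinality, then some finite
family of pairwise distant points is a net of `S`. -/
theorem exists_separated_net {α : Type*} {close : α → α → Prop} (hsymm : ∀ x y, close x y → close y x)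
    (hrefl : ∀ x, close x x) {S : Set α} {M : ℕ}
    (hM : ∀ F : Finset α, ↑F ⊆ S → (F : Set α).Pairwise (fun x y => ¬ close x y) → F.card ≤ M) :
    ∃ F : Finset α, ↑F ⊆ S ∧ (F : Set α).Pairwise (fun x y => ¬ close x y) ∧ F.card ≤ M ∧
      ∀ u ∈ S, ∃ f ∈ F, close u f := by
  classical
  let C : Set ℕ := {k | ∃ F : Finset α, ↑F ⊆ S ∧
    (F : Set α).Pairwise (fun x y => ¬ close x y) ∧ F.card = k}
  have hfin : C.Finite := (Set.finite_Iic M).subset fun k ⟨F, h1, h2, h3⟩ => h3 ▸ hM F h1 h2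
  obtain ⟨k, ⟨F, h1, h2, h3⟩, hk⟩ := Set.exists_max_image C id hfin ⟨0, ∅, by simp, by simp, rfl⟩
  refine ⟨F, h1, h2, hM F h1 h2, fun u hu => ?_⟩
  by_contra! hfar
  have huF : u ∉ F := fun h => hfar u h (hrefl u)
  have h4 : (insert u F).card ∈ C := by
    refine ⟨insert u F, ?_, ?_, rfl⟩
    · rw [Finset.coe_insert]
      exact Set.insert_subset hu h1
    · rw [Finset.coe_insert]
      exact h2.insert fun b hb _ => ⟨hfar b hb, fun h => hfar b hb (hsymm _ _ h)⟩
  have h5 : (insert u F).card ≤ k := hk _ h4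
  rw [Finset.card_insert_of_notMem huF, h3] at h5
  omega

section Packing

variable {E : Type*} [NormedAddCommGroup E] [NormedSpace ℝ E]

/-- After rescaling to `s = 1`, each ball of radius `1/2` in a fixed finite cover of the ball of
radius `L` holds at most one point; hence `M` depends on neither `c` nor `s`. -/
theorem exists_packing_bound [ProperSpace E] (L : ℝ) : ∃ M : ℕ, ∀ (c : E) (s : ℝ), 0 < s →
    ∀ F : Finset E, ↑F ⊆ Metric.closedBall c (L * s) →
      (F : Set E).Pairwise (fun x y => s ≤ dist x y) → F.card ≤ M := by
  obtain ⟨t, ht, hcov⟩ := Metric.totallyBounded_iff.1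
    (isCompact_closedBall (0 : E) L).totallyBounded (1 / 2) (by norm_num)
  refine ⟨ht.toFinset.card, fun c s hs F hF hsep => ?_⟩
  have h1 : ∀ f ∈ F, ∃ y ∈ t, dist (s⁻¹ • (f - c)) y < 1 / 2 := by
    intro f hf
    have h2 : s⁻¹ • (f - c) ∈ Metric.closedBall (0 : E) L := by
      have h3 := hF hf
      rw [mem_closedBall_iff_norm] at h3
      rw [mem_closedBall_zero_iff, norm_smul, Real.norm_of_nonneg (by positivity),
        inv_mul_le_iff₀ hs]
      linarith
    simpa using hcov h2
  choose! g hg hgd using h1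
  refine Finset.card_le_card_of_injOn g (fun f hf => by simpa using hg f hf) fun f hf f' hf' e => ?_
  by_contra hne
  have h2 := hsep hf hf' hne
  have h3 : dist (s⁻¹ • (f - c)) (s⁻¹ • (f' - c)) < 1 := by
    have h4 := hgd f' hf'
    rw [← e] at h4
    linarith [dist_triangle_right (s⁻¹ • (f - c)) (s⁻¹ • (f' - c)) (g f), hgd f hf]
  rw [dist_smul₀, dist_sub_right, Real.norm_of_nonneg (by positivity), inv_mul_lt_iff₀ hs] at h3
  linarith

end Packing

section Nets

variable {X : Type*} [MetricSpace X]

/-- A finite metric space has a scale function all of whose superlevel sets are separated nets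
(farthest point ordering). -/
theorem exists_scale_function {Y : Finset X} (hY : Y.Nonempty) {B : ℝ} (hB : 0 < B)
    (hYB : ∀ x ∈ Y, ∀ y ∈ Y, dist x y ≤ B) :
    ∃ ℓ : X → ℝ, (∀ y ∈ Y, 0 < ℓ y) ∧
      (∀ x ∈ Y, ∀ y ∈ Y, x ≠ y → min (ℓ x) (ℓ y) ≤ dist x y) ∧
      ∀ s, 0 < s → s ≤ B → ∀ y ∈ Y, ∃ x ∈ Y, s ≤ ℓ x ∧ dist x y ≤ s := by
  classical
  -- Points are added greedily: the new one is farthest from `Z`, and its scale is its distance to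
  -- `Z`. The last clause, that every scale is at least the covering radius of `Z`, carries the
  -- induction.
  have key : ∀ k, 1 ≤ k → k ≤ Y.card → ∃ Z ⊆ Y, Z.card = k ∧ ∃ ℓ : X → ℝ, (∀ y ∈ Z, 0 < ℓ y) ∧
      (∀ x ∈ Z, ∀ y ∈ Z, x ≠ y → min (ℓ x) (ℓ y) ≤ dist x y) ∧
      (∀ s, 0 < s → s ≤ B → (∀ y ∈ Y, Metric.infDist y Z ≤ s) →
        ∀ y ∈ Y, ∃ x ∈ Z, s ≤ ℓ x ∧ dist x y ≤ s) ∧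
      ∀ y ∈ Y, ∀ z ∈ Z, Metric.infDist y Z ≤ ℓ z := by
    intro k hk
    induction k, hk using Nat.le_induction with
    | base =>
      intro _
      obtain ⟨x, hx⟩ := hY
      refine ⟨{x}, by simpa using hx, by simp, fun _ => B, fun _ _ => hB, ?_, ?_, ?_⟩
      · intro a ha b hb hab
        rw [Finset.mem_singleton] at ha hb
        exact (hab (ha.trans hb.symm)).elim
      · intro s _ hs h y hy
        refine ⟨x, Finset.mem_singleton_self x, hs, ?_⟩
        have := h y hy
        rwa [Finset.coe_singleton, Metric.infDist_singleton, dist_comm] at this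
      · intro y hy z _
        rw [Finset.coe_singleton, Metric.infDist_singleton]
        exact hYB y hy x hx
    | succ k hk ih =>
      intro hkY
      obtain ⟨Z, hZY, hZk, ℓ, hpos, hsep, hnet, hbig⟩ := ih (by omega)
      have hZne : Z.Nonempty := Finset.card_pos.1 (by omega)
      obtain ⟨y₁, hy₁, hy₁Z⟩ : ∃ y ∈ Y, y ∉ Z := Finset.exists_mem_notMem_of_card_lt_card (by omega)
      obtain ⟨y₀, hy₀, hmax⟩ := Finset.exists_max_image Y (fun y => Metric.infDist y Z) hY
      have ht1 : 0 < Metric.infDist y₁ Z :=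
        (Z.finite_toSet.isClosed.notMem_iff_infDist_pos (by simpa using hZne)).1 (by simpa using hy₁Z)
      have ht : 0 < Metric.infDist y₀ Z := ht1.trans_le (hmax y₁ hy₁)
      have hy₀Z : y₀ ∉ Z := fun h => by
        rw [Metric.infDist_zero_of_mem (by simpa using h)] at ht
        exact ht.false
      have hupd : ∀ z ∈ Z, Function.update ℓ y₀ (Metric.infDist y₀ Z) z = ℓ z := fun z hz =>
        Function.update_of_ne (ne_of_mem_of_not_mem hz hy₀Z) _ _
      have hanti : ∀ y : X, Metric.infDist y ↑(insert y₀ Z) ≤ Metric.infDist y ↑Z := fun y =>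
        Metric.infDist_le_infDist_of_subset (by simp) (by simpa using hZne)
      have hge : ∀ z ∈ insert y₀ Z, Metric.infDist y₀ Z ≤
          Function.update ℓ y₀ (Metric.infDist y₀ Z) z := by
        intro z hz
        rcases Finset.mem_insert.1 hz with rfl | hz
        · simp
        · rw [hupd z hz]
          exact hbig y₀ hy₀ z hz
      refine ⟨insert y₀ Z, Finset.insert_subset hy₀ hZY, by
        rw [Finset.card_insert_of_notMem hy₀Z, hZk], Function.update ℓ y₀ (Metric.infDist y₀ Z),
        fun z hz => ht.trans_le (hge z hz), ?_, ?_, ?_⟩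
      · intro a ha b hb hab
        rcases Finset.mem_insert.1 ha with rfl | ha' <;>
          rcases Finset.mem_insert.1 hb with rfl | hb'
        · exact (hab rfl).elim
        · refine (min_le_left _ _).trans ?_
          rw [Function.update_self]
          exact Metric.infDist_le_dist_of_mem (by simpa using hb')
        · refine (min_le_right _ _).trans ?_
          rw [Function.update_self, dist_comm]
          exact Metric.infDist_le_dist_of_mem (by simpa using ha')
        · rw [hupd a ha', hupd b hb']
          exact hsep a ha' b hb' hab
      · intro s hs hsB hcov y hy
        -- If the old points already form an `s`-net, the induction hypothesis applies; otherwise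
        -- every scale exceeds `s` and any nearest point will do.
        rcases le_or_gt (Metric.infDist y₀ Z) s with hts | hts
        · obtain ⟨x, hx, h1, h2⟩ := hnet s hs hsB (fun y hy => (hmax y hy).trans hts) y hy
          exact ⟨x, Finset.mem_insert_of_mem hx, by rwa [hupd x hx], h2⟩
        · obtain ⟨x, hx, h1⟩ := (insert y₀ Z).finite_toSet.isCompact.exists_infDist_eq_dist
            ⟨y₀, by simp⟩ y
          have hx' : x ∈ insert y₀ Z := by simpa using hx
          exact ⟨x, hx', hts.le.trans (hge x hx'), by rw [dist_comm, ← h1]; exact hcov y hy⟩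
      · intro y hy z hz
        exact (hanti y).trans ((hmax y hy).trans (hge z hz))
  obtain ⟨Z, hZY, hZk, ℓ, hpos, hsep, hnet, -⟩ := key Y.card (Finset.card_pos.2 hY) le_rfl
  obtain rfl := Finset.eq_of_subset_of_card_le hZY hZk.ge
  refine ⟨ℓ, hpos, hsep, fun s hs hsB => hnet s hs hsB fun y hy => ?_⟩
  rw [Metric.infDist_zero_of_mem (by simpa using hy)]
  exact hs.le

end Nets

/-- A finite set `Y` has linearly many (point, scale) pairs that approximate every pair of points
of `Y`, with a constant that depends on the ambient space only. -/
theorem exists_linear_scale_pairs (E : Type*) [NormedAddCommGroup E] [NormedSpace ℝ E]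
    [ProperSpace E] :
    ∃ M : ℕ, ∀ Y : Finset E, Y.Nonempty → (∀ x ∈ Y, ∀ y ∈ Y, dist x y ≤ 2) →
      ∃ P : Finset (E × ℝ), P.card ≤ M * Y.card ∧ (∀ q ∈ P, q.1 ∈ Y ∧ 0 < q.2) ∧
        (∀ y ∈ Y, ∃ ℓ, (y, ℓ) ∈ P) ∧
        ∀ x ∈ Y, ∀ y ∈ Y, x ≠ y → ∃ q ∈ P, dist q.1 x ≤ dist x y / 4 ∧
          dist x y / 4 ≤ q.2 ∧ q.2 ≤ 2 * dist x y := by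
  classical
  obtain ⟨M, hM⟩ := exists_packing_bound (E := E) 8
  refine ⟨M, fun Y hY hY2 => ?_⟩
  obtain ⟨ℓ, hpos, hsep, hnet⟩ := exists_scale_function hY (by norm_num) hY2
  -- A pair is charged to its second point `m`, the one of smaller scale: the admissible first
  -- points are `ℓ m`-separated in a ball of radius `8 ℓ m`, so their number is bounded by packing.
  let Q := (Y ×ˢ Y).filter fun q => ℓ q.2 ≤ ℓ q.1 ∧ dist q.1 q.2 ≤ 8 * ℓ q.2
  have hQ : ∀ q, q ∈ Q ↔ (q.1 ∈ Y ∧ q.2 ∈ Y) ∧ ℓ q.2 ≤ ℓ q.1 ∧ dist q.1 q.2 ≤ 8 * ℓ q.2 := by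
    intro q
    simp [Q]
  have hQcard : Q.card ≤ M * Y.card := by
    refine Finset.card_le_mul_card_image_of_maps_to (f := Prod.snd) (fun q hq => ((hQ q).1 hq).1.2)
      M fun m hm => ?_
    have hinj : Set.InjOn Prod.fst (↑(Q.filter fun q => q.2 = m) : Set (E × E)) := by
      intro p hp q hq e
      simp only [Finset.coe_filter, Set.mem_ofPred_eq] at hp hq
      exact Prod.ext e (hp.2.trans hq.2.symm)
    rw [← Finset.card_image_of_injOn hinj]
    have hmem : ∀ a ∈ (Q.filter fun q => q.2 = m).image Prod.fst,
        a ∈ Y ∧ ℓ m ≤ ℓ a ∧ dist a m ≤ 8 * ℓ m := by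
      intro a ha
      obtain ⟨q, hq, rfl⟩ := Finset.mem_image.1 ha
      obtain ⟨hq', rfl⟩ := Finset.mem_filter.1 hq
      exact ⟨((hQ q).1 hq').1.1, ((hQ q).1 hq').2⟩
    refine hM m (ℓ m) (hpos m hm) _ (fun a ha => (hmem a ha).2.2) fun a ha b hb hab => ?_
    exact (le_min (hmem a ha).2.1 (hmem b hb).2.1).trans
      (hsep a (hmem a ha).1 b (hmem b hb).1 hab)
  refine ⟨Q.image fun q => (q.1, ℓ q.2), Finset.card_image_le.trans hQcard, ?_, ?_, ?_⟩
  · intro q hq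
    obtain ⟨p, hp, rfl⟩ := Finset.mem_image.1 hq
    exact ⟨((hQ p).1 hp).1.1, hpos _ ((hQ p).1 hp).1.2⟩
  · intro y hy
    exact ⟨ℓ y, Finset.mem_image.2 ⟨(y, y), (hQ _).2 ⟨⟨hy, hy⟩, le_rfl, by
      simpa using (hpos y hy).le⟩, rfl⟩⟩
  · intro x hx y hy hxy
    have hR := dist_pos.2 hxy
    have hR2 := hY2 x hx y hy
    -- Net points `a` near `x` and `b` near `y` at scale `dist x y / 4` are distinct, so the smaller
    -- of their scales is at most `dist a b ≤ 3/2 * dist x y`. The chosen pair is always `a` with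
    -- that smaller scale.
    obtain ⟨a, ha, hla, hax⟩ := hnet (dist x y / 4) (by linarith) (by linarith) x hx
    obtain ⟨b, hb, hlb, hby⟩ := hnet (dist x y / 4) (by linarith) (by linarith) y hy
    have h1 : dist x y ≤ dist a x + dist a b + dist b y := by
      have := dist_triangle4 x a b y
      rwa [dist_comm x a] at this
    have h2 : dist a b ≤ dist a x + dist x y + dist b y := by
      have := dist_triangle4 a x y b
      rwa [dist_comm y b] at this
    have hab : a ≠ b := fun h => by
      rw [h, dist_self] at h1
      rw [h] at hax
      linarith
    have h3 := hsep a ha b hb hab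
    rcases le_total (ℓ a) (ℓ b) with h | h
    · rw [min_eq_left h] at h3
      exact ⟨(a, ℓ a), Finset.mem_image.2 ⟨(a, a), (hQ _).2 ⟨⟨ha, ha⟩, le_rfl, by
        simpa using (hpos a ha).le⟩, rfl⟩, hax, hla, by dsimp only; linarith⟩
    · rw [min_eq_right h] at h3
      exact ⟨(a, ℓ b), Finset.mem_image.2 ⟨(a, b), (hQ _).2 ⟨⟨ha, hb⟩, h, by
        dsimp only; linarith⟩, rfl⟩, hax, hlb, by dsimp only; linarith⟩

/-! ### Depth of an ideal hull below the sphere, and its cover by cusps. -/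

section Depth

variable {E : Type*} [NormedAddCommGroup E] [InnerProductSpace ℝ E]

/-- On the unit sphere this turns a half-space condition with normal `v` into a comparison of
distances to `v`. -/
theorem inner_sub_inner_of_norm_eq_one {x y v : E} (hx : ‖x‖ = 1) (hy : ‖y‖ = 1) :
    inner ℝ x v - inner ℝ y v = (‖y - v‖ ^ 2 - ‖x - v‖ ^ 2) / 2 := by
  rw [norm_sub_sq_real, norm_sub_sq_real, hx, hy]
  ring

/-- If the sites near `θ` are concentrated around the nearest site `y₁` at distance `r`, and the
other ones have distance at least `R` from `y₁`, then the convex hull of the sites and the origin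
stays at distance `≥ r R / 96` from the sphere in direction `θ`. -/
theorem depth_of_gap {Y : Set E} (hY : ∀ y ∈ Y, ‖y‖ = 1) {θ y₁ : E} (hθ : ‖θ‖ = 1) (hy₁ : ‖y₁‖ = 1)
    (hr : 0 < ‖θ - y₁‖) (hnear : ∀ y ∈ Y, ‖θ - y₁‖ ≤ ‖y - θ‖) {R : ℝ} (hR2 : R ≤ 2)
    (hgap : ∀ y ∈ Y, ‖y - y₁‖ < ‖θ - y₁‖ / 2 ∨ R ≤ ‖y - y₁‖) {ρ : ℝ}
    (hp : ρ • θ ∈ convexHull ℝ (insert 0 Y)) : ‖θ - y₁‖ * R / 96 ≤ 1 - ρ := by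
  set r := ‖θ - y₁‖ with hrdef
  have hr2 : r ≤ 2 := by
    have := norm_sub_le θ y₁
    rw [hθ, hy₁] at this
    linarith
  -- The separating normal `v` lies on the ray from `y₁` through `θ`, at distance `τ r` from `y₁`.
  -- If `τ > 1`, then `R = 4 τ r`: sites within `r/2` of `y₁` are at distance at least `(τ - 1/2) r`
  -- from `v`, the others at least `3 τ r`, and `θ` is only `(τ - 1) r` away. If `τ = 1`, then `v =
  -- θ` and `hnear` suffices.
  set τ := max 1 (R / (4 * r)) with hτ
  have hτ1 : 1 ≤ τ := le_max_left _ _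
  have hτR : R / 4 ≤ τ * r := by
    have : R / (4 * r) ≤ τ := le_max_right _ _
    rw [div_le_iff₀ (by positivity)] at this
    linarith
  have hτ2 : τ * r ≤ 2 := by
    rcases max_choice 1 (R / (4 * r)) with h | h
    · rw [hτ, h]; linarith
    · rw [hτ, h]
      have : R / (4 * r) * r = R / 4 := by field_simp
      linarith
  set v := y₁ + τ • (θ - y₁) with hv
  have hθg : inner ℝ θ (θ - y₁) = r ^ 2 / 2 := by
    rw [hrdef, norm_sub_sq_real, hθ, hy₁, inner_sub_right, real_inner_self_eq_norm_sq, hθ]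
    ring
  have hθv : inner ℝ θ v = 1 + (τ - 1) * (r ^ 2 / 2) := by
    have : v = θ + (τ - 1) • (θ - y₁) := by rw [hv]; module
    rw [this, inner_add_right, real_inner_smul_right, hθg, real_inner_self_eq_norm_sq, hθ]
    ring
  have hdθ : ‖θ - v‖ ^ 2 = (τ - 1) ^ 2 * r ^ 2 := by
    have : θ - v = (1 - τ) • (θ - y₁) := by rw [hv]; module
    rw [this, norm_smul, mul_pow, Real.norm_eq_abs, sq_abs, ← hrdef]
    ring
  have hvy : ‖v - y₁‖ = τ * r := by
    rw [hv, add_sub_cancel_left, norm_smul, Real.norm_of_nonneg (by linarith)]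
  have hsite : ∀ y ∈ Y, inner ℝ v y ≤ inner ℝ θ v - τ * r ^ 2 / 8 := by
    intro y hy
    have h1 := inner_sub_inner_of_norm_eq_one (v := v) hθ (hY y hy)
    rw [hdθ] at h1
    rw [real_inner_comm]
    suffices h : (τ - 1) ^ 2 * r ^ 2 + τ * r ^ 2 / 4 ≤ ‖y - v‖ ^ 2 by linarith
    rcases max_choice 1 (R / (4 * r)) with h | h
    · have hτe : τ = 1 := h
      have hve : v = θ := by rw [hv, hτe]; module
      rw [hve, hτe]
      have := pow_le_pow_left₀ hr.le (hnear y hy) 2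
      nlinarith
    · have hτe : τ = R / (4 * r) := h
      have hRe : R = 4 * (τ * r) := by rw [hτe]; field_simp
      have htri := norm_sub_norm_le (v - y₁) (y - y₁)
      have htri' := norm_sub_norm_le (y - y₁) (v - y₁)
      rw [sub_sub_sub_cancel_right, hvy] at htri htri'
      rw [norm_sub_rev v y] at htri
      rcases hgap y hy with h2 | h2
      · have h3 : (τ - 1 / 2) * r ≤ ‖y - v‖ := by linarith
        have h4 := pow_le_pow_left₀ (mul_nonneg (by linarith) hr.le) h3 2
        nlinarith [sq_nonneg r]
      · have h3 : 3 * τ * r ≤ ‖y - v‖ := by linarith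
        have h4 := pow_le_pow_left₀ (mul_nonneg (by linarith) hr.le) h3 2
        have h5 : (τ - 1) ^ 2 + τ / 4 ≤ 9 * τ ^ 2 := by nlinarith
        nlinarith [sq_nonneg r]
  have hhalf : convexHull ℝ (insert 0 Y) ⊆ {x | inner ℝ v x ≤ inner ℝ θ v - τ * r ^ 2 / 8} := by
    refine convexHull_min (Set.insert_subset ?_ hsite) ?_
    · simp only [Set.mem_ofPred_eq, inner_zero_right]
      rw [hθv]
      have h1 : τ * r * r ≤ 2 * 2 := mul_le_mul hτ2 hr2 hr.le (by norm_num)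
      have h2 : 0 ≤ (τ - 1) * (r ^ 2 / 2) := mul_nonneg (by linarith) (by positivity)
      nlinarith
    · exact convex_halfSpace_le (innerₛₗ ℝ v).isLinear _
  have hfin := hhalf hp
  simp only [Set.mem_ofPred_eq, real_inner_smul_right] at hfin
  rw [real_inner_comm, hθv] at hfin
  have h1 : τ * r * r ≤ 2 * 2 := mul_le_mul hτ2 hr2 hr.le (by norm_num)
  have h2 : 0 ≤ (τ - 1) * (r ^ 2 / 2) := mul_nonneg (by linarith) (by positivity)
  have h3 : R / 4 * r ≤ τ * r * r := mul_le_mul_of_nonneg_right hτR hr.le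
  have h4 : τ * r ^ 2 / 8 ≤ (1 - ρ) * (1 + (τ - 1) * (r ^ 2 / 2)) := by linarith
  have h5 : 0 ≤ 1 - ρ := by
    by_contra! hneg
    have : 0 < τ * r ^ 2 / 8 := by positivity
    nlinarith
  -- The constant is `96 = 4 * 8 * 3`: from `τ r ≥ R / 4`, the margin `τ r² / 8` and `⟨θ, v⟩ ≤ 3`.
  have h6 : (1 - ρ) * (1 + (τ - 1) * (r ^ 2 / 2)) ≤ (1 - ρ) * 3 :=
    mul_le_mul_of_nonneg_left (by nlinarith) h5
  nlinarith

/-- The convex hull of the origin and `N` points of the unit sphere is covered by `O(N)` cusp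
regions. -/
theorem exists_cusp_cover (E : Type*) [NormedAddCommGroup E] [InnerProductSpace ℝ E]
    [ProperSpace E] :
    ∃ M : ℕ, ∀ Y : Finset E, Y.Nonempty → (∀ y ∈ Y, ‖y‖ = 1) →
      ∃ P : Finset (E × ℝ), P.card ≤ M * Y.card ∧ (∀ q ∈ P, q.1 ∈ Y ∧ 0 < q.2) ∧
        ∀ p ∈ convexHull ℝ (insert 0 (Y : Set E)), p ≠ 0 → ‖p‖ < 1 → ∃ q ∈ P,
          ‖‖p‖⁻¹ • p - q.1‖ ≤ 384 * q.2 ∧ ‖‖p‖⁻¹ • p - q.1‖ * q.2 ≤ 384 * (1 - ‖p‖) := by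
  classical
  obtain ⟨M, hM⟩ := exists_linear_scale_pairs E
  refine ⟨M + 1, fun Y hYne hY => ?_⟩
  have hY2 : ∀ x ∈ Y, ∀ y ∈ Y, dist x y ≤ 2 := fun x hx y hy => by
    have := norm_sub_le x y
    rw [hY x hx, hY y hy] at this
    rw [dist_eq_norm]
    linarith
  obtain ⟨P, hPc, hPpos, hPall, hPpair⟩ := hM Y hYne hY2
  obtain ⟨y₀, hy₀⟩ := hYne
  -- The extra pair of scale `1` serves directions from which all sites look clustered around the
  -- nearest one, so that no second site provides a scale.
  refine ⟨insert (y₀, 1) P, ?_, ?_, fun p hp hp0 hp1 => ?_⟩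
  · have h1 : 1 ≤ Y.card := Finset.card_pos.2 ⟨y₀, hy₀⟩
    have := Finset.card_insert_le (y₀, (1 : ℝ)) P
    nlinarith
  · intro q hq
    rcases Finset.mem_insert.1 hq with rfl | hq
    · exact ⟨hy₀, one_pos⟩
    · exact hPpos q hq
  set θ := ‖p‖⁻¹ • p with hθdef
  have hpn := norm_pos_iff.2 hp0
  have hθ : ‖θ‖ = 1 := by rw [hθdef, norm_smul, norm_inv, norm_norm, inv_mul_cancel₀ hpn.ne']
  have hpθ : ‖p‖ • θ = p := by rw [hθdef, smul_smul, mul_inv_cancel₀ hpn.ne', one_smul]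
  obtain ⟨y₁, hy₁, hmin⟩ := Finset.exists_min_image Y (fun y => ‖y - θ‖) ⟨y₀, hy₀⟩
  have hr0 := norm_nonneg (θ - y₁)
  rcases hr0.eq_or_lt with hr | hr
  · obtain ⟨ℓ, hℓ⟩ := hPall y₁ hy₁
    refine ⟨_, Finset.mem_insert_of_mem hℓ, ?_, ?_⟩
    · rw [← hr]
      linarith [(hPpos _ hℓ).2]
    · rw [← hr]
      linarith
  have hdepth := fun R h2 hg => depth_of_gap (Y := (Y : Set E)) (R := R) (by simpa using hY) hθ
    (hY y₁ hy₁) hr (fun y hy => by rw [norm_sub_rev]; exact hmin y (by simpa using hy)) h2 hg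
    (hpθ.symm ▸ hp)
  have hr2 : ‖θ - y₁‖ ≤ 2 := by
    have := norm_sub_le θ y₁
    rw [hθ, hY y₁ hy₁] at this
    linarith
  rcases (Y.filter fun y => ‖θ - y₁‖ / 2 ≤ ‖y - y₁‖).eq_empty_or_nonempty with hfar | hfar
  · have hclose : ∀ y ∈ Y, ‖y - y₁‖ < ‖θ - y₁‖ / 2 := fun y hy => by
      by_contra! h
      exact Finset.notMem_empty y (hfar ▸ Finset.mem_filter.2 ⟨hy, h⟩)
    have h1 := hdepth 2 le_rfl fun y hy => Or.inl (hclose y (by simpa using hy))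
    have h2 : ‖θ - y₀‖ ≤ ‖θ - y₁‖ + ‖y₁ - y₀‖ := norm_sub_le_norm_sub_add_norm_sub _ _ _
    rw [norm_sub_rev y₁] at h2
    have h3 := hclose y₀ hy₀
    refine ⟨_, Finset.mem_insert_self _ _, ?_, ?_⟩ <;> dsimp only <;> linarith
  -- The gap ends at the site `z` nearest to `y₁` among those outside radius `r/2`. The
  -- approximating site `q.1` is closer to `y₁` than `z`, so it falls inside radius `r/2`.
  · obtain ⟨z, hz, hzmin⟩ := Finset.exists_min_image _ (fun y => ‖y - y₁‖) hfar
    obtain ⟨hzY, hzr⟩ := Finset.mem_filter.1 hz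
    have hgap : ∀ y ∈ Y, ‖y - y₁‖ < ‖θ - y₁‖ / 2 ∨ ‖z - y₁‖ ≤ ‖y - y₁‖ := fun y hy => by
      by_contra! h
      exact absurd (hzmin y (Finset.mem_filter.2 ⟨hy, h.1⟩)) (not_le.2 h.2)
    have hz2 : ‖z - y₁‖ ≤ 2 := by rw [← dist_eq_norm]; exact hY2 z hzY y₁ hy₁
    have h1 := hdepth ‖z - y₁‖ hz2 fun y hy => hgap y (by simpa using hy)
    have hne : y₁ ≠ z := fun h => by
      rw [h, sub_self, norm_zero] at hzr
      rw [← h] at hzr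
      linarith
    obtain ⟨q, hq, hq1, hq2, hq3⟩ := hPpair y₁ hy₁ z hzY hne
    rw [dist_comm y₁ z, dist_eq_norm z y₁] at hq1 hq2 hq3
    rw [dist_eq_norm] at hq1
    have hqr : ‖q.1 - y₁‖ < ‖θ - y₁‖ / 2 := by
      rcases hgap q.1 (hPpos q hq).1 with h | h
      · exact h
      · linarith
    have h2 : ‖θ - q.1‖ ≤ ‖θ - y₁‖ + ‖y₁ - q.1‖ := norm_sub_le_norm_sub_add_norm_sub _ _ _
    rw [norm_sub_rev y₁] at h2
    have h3 : ‖θ - q.1‖ ≤ 2 * ‖θ - y₁‖ := by linarith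
    refine ⟨q, Finset.mem_insert_of_mem hq, by linarith, ?_⟩
    calc ‖θ - q.1‖ * q.2 ≤ 2 * ‖θ - y₁‖ * (2 * ‖z - y₁‖) :=
          mul_le_mul h3 hq3 (hPpos q hq).2.le (by linarith)
      _ ≤ 384 * (1 - ‖p‖) := by linarith

end Depth

/-! ### Volumes of cones, shells and cusps. -/

theorem sum_min_two_pow_le (N : ℕ) {u : ℝ} (hu : 0 < u) :
    ∑ k ∈ Finset.range N, min (2 ^ k * u) (1 / (2 ^ k * u)) ≤ 4 := by
  -- Dropping the first term replaces `u` by `2u`; separate bounds for the rising and the decaying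
  -- regime make the induction close.
  suffices h : ∀ u : ℝ, 0 < u →
      (u ≤ 1 → ∑ k ∈ Finset.range N, min (2 ^ k * u) (1 / (2 ^ k * u)) ≤ 4 - u) ∧
      (1 ≤ u → ∑ k ∈ Finset.range N, min (2 ^ k * u) (1 / (2 ^ k * u)) ≤ 2 / u) by
    rcases le_total u 1 with h1 | h1
    · linarith [(h u hu).1 h1]
    · have : 2 / u ≤ 2 := div_le_self (by norm_num) h1
      linarith [(h u hu).2 h1]
  induction N with
  | zero => exact fun u hu => ⟨fun h => by simp; linarith, fun h => by simp; positivity⟩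
  | succ N ih =>
    intro u hu
    obtain ⟨i1, i2⟩ := ih (2 * u) (by positivity)
    have e : ∑ k ∈ Finset.range (N + 1), min (2 ^ k * u) (1 / (2 ^ k * u)) =
        ∑ k ∈ Finset.range N, min (2 ^ k * (2 * u)) (1 / (2 ^ k * (2 * u))) + min u (1 / u) := by
      rw [Finset.sum_range_succ']
      simp only [pow_succ, pow_zero, one_mul, mul_assoc]
    rw [e]
    have m1 := min_le_left u (1 / u)
    have m2 := min_le_right u (1 / u)
    have e2 : 2 / (2 * u) = 1 / u := by field_simp
    rw [e2] at i2
    refine ⟨fun h => ?_, fun h => ?_⟩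
    · rcases le_total (2 * u) 1 with h1 | h1
      · linarith [i1 h1]
      · have h2 : 1 / u ≤ 4 - 2 * u := by
          rw [div_le_iff₀ hu]
          nlinarith
        linarith [i2 h1]
    · have h2 : 2 / u = 1 / u + 1 / u := by ring
      linarith [i2 (by linarith)]

section Cone

variable {E : Type*} [NormedAddCommGroup E] [NormedSpace ℝ E]

/-- The cone of the vectors whose direction has distance at most `t` from `a`. -/
def directionCone (a : E) (t : ℝ) : Set E := {p | ‖‖p‖⁻¹ • p - a‖ ≤ t}

theorem measurableSet_directionCone [MeasurableSpace E] [BorelSpace E]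
    [SecondCountableTopology E] (a : E) (t : ℝ) :
    MeasurableSet (directionCone a t) := by
  unfold directionCone
  measurability

open scoped Pointwise in
theorem directionCone_inter_ball (a : E) (t : ℝ) {ρ : ℝ} (hρ : 0 < ρ) :
    directionCone a t ∩ Metric.ball 0 ρ = ρ • (directionCone a t ∩ Metric.ball 0 1) := by
  ext p
  rw [Set.mem_smul_set_iff_inv_smul_mem₀ hρ.ne']
  have h1 : ‖ρ⁻¹ • p‖ = ρ⁻¹ * ‖p‖ := by rw [norm_smul, Real.norm_of_nonneg (by positivity)]
  have h2 : ‖ρ⁻¹ • p‖⁻¹ • ρ⁻¹ • p = ‖p‖⁻¹ • p := by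
    rw [h1, smul_smul, mul_inv, inv_inv]
    congr 1
    field_simp
  simp only [Set.mem_inter_iff, directionCone, Set.mem_ofPred_eq, mem_ball_zero_iff]
  rw [h2, h1, inv_mul_lt_iff₀ hρ, mul_one]

variable [MeasurableSpace E] [BorelSpace E] [FiniteDimensional ℝ E] (μ : Measure E)
  [μ.IsAddHaarMeasure]

/-- The part of the cone removed from the unit ball is its dilate by `1 - s`. For `s = 1` it is
empty, matching `0 ^ finrank = 0` as the dimension is not zero. -/
theorem measure_cone_shell (a : E) (t : ℝ) {s : ℝ} (hs : 0 ≤ s) (hs1 : s ≤ 1)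
    (hE : Module.finrank ℝ E ≠ 0) :
    μ (directionCone a t ∩ {p | 1 - s ≤ ‖p‖} ∩ Metric.ball 0 1) =
      ENNReal.ofReal (1 - (1 - s) ^ Module.finrank ℝ E) *
        μ (directionCone a t ∩ Metric.ball 0 1) := by
  have e : directionCone a t ∩ {p | 1 - s ≤ ‖p‖} ∩ Metric.ball 0 1 =
      (directionCone a t ∩ Metric.ball 0 1) \ (directionCone a t ∩ Metric.ball 0 (1 - s)) := by
    ext p
    simp only [Set.mem_inter_iff, Set.mem_ofPred_eq, Set.mem_sdiff, mem_ball_zero_iff]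
    constructor
    · rintro ⟨⟨h1, h2⟩, h3⟩
      exact ⟨⟨h1, h3⟩, fun h => absurd h.2 (not_lt.2 h2)⟩
    · rintro ⟨⟨h1, h3⟩, h⟩
      exact ⟨⟨h1, not_lt.1 fun h2 => h ⟨h1, h2⟩⟩, h3⟩
  have hball : μ (directionCone a t ∩ Metric.ball 0 (1 - s)) =
      ENNReal.ofReal ((1 - s) ^ Module.finrank ℝ E) *
        μ (directionCone a t ∩ Metric.ball 0 1) := by
    rcases hs1.eq_or_lt with rfl | hs1
    · simp [hE]
    · rw [directionCone_inter_ball a t (by linarith : 0 < 1 - s),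
        Measure.addHaar_smul_of_nonneg μ (sub_nonneg.2 hs1.le)]
  have hfin : μ (directionCone a t ∩ Metric.ball 0 1) ≠ ∞ :=
    measure_ne_top_of_subset Set.inter_subset_right measure_ball_lt_top.ne
  have hfin' : μ (directionCone a t ∩ Metric.ball 0 (1 - s)) ≠ ∞ :=
    measure_ne_top_of_subset Set.inter_subset_right measure_ball_lt_top.ne
  rw [e, measure_sdiff _ _ hfin', hball, ENNReal.ofReal_sub _ (by
    exact pow_nonneg (by linarith) _), ENNReal.ofReal_one, ENNReal.sub_mul (fun _ _ => hfin),
    one_mul]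
  · exact Set.inter_subset_inter_right _ (Metric.ball_subset_ball (by linarith))
  · exact ((measurableSet_directionCone a t).inter measurableSet_ball).nullMeasurableSet

/-- For `t ≤ 1` the outer shell of thickness `t` contains at least the fraction `t` of the truncated
cone and fits into a ball of radius `2t`; dividing `(2t) ^ (d + 1)` by `t` gives the bound without
any measure on the sphere. -/
theorem measure_directionCone_le {d : ℕ} (hE : Module.finrank ℝ E = d + 1) (a : E) {t : ℝ}
    (ht : 0 < t) :
    μ (directionCone a t ∩ Metric.ball 0 1) ≤
      ENNReal.ofReal (2 ^ (d + 1) * t ^ d) * μ (Metric.ball 0 1) := by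
  rcases le_or_gt t 1 with ht1 | ht1
  · have h1 := measure_cone_shell μ a t ht.le ht1 (by omega)
    have h2 : directionCone a t ∩ {p | 1 - t ≤ ‖p‖} ∩ Metric.ball 0 1 ⊆
        Metric.closedBall a (2 * t) := by
      rintro p ⟨⟨hp, hpt⟩, hp1⟩
      rw [mem_ball_zero_iff] at hp1
      simp only [directionCone, Set.mem_ofPred_eq] at hp hpt
      have h3 : ‖p - ‖p‖⁻¹ • p‖ ≤ t := by
        rcases eq_or_ne p 0 with rfl | hp0
        · simpa using ht.le
        · have hpn := norm_pos_iff.2 hp0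
          have : p - ‖p‖⁻¹ • p = (1 - ‖p‖⁻¹) • p := by module
          rw [this, norm_smul, Real.norm_of_nonpos (by
            rw [sub_nonpos]; exact (one_le_inv₀ hpn).2 hp1.le)]
          have : -(1 - ‖p‖⁻¹) * ‖p‖ = 1 - ‖p‖ := by field_simp; ring
          linarith
      rw [mem_closedBall_iff_norm]
      have := norm_sub_le_norm_sub_add_norm_sub p (‖p‖⁻¹ • p) a
      linarith
    have h3 := measure_mono (μ := μ) h2
    rw [h1, Measure.addHaar_closedBall μ a (by linarith), hE] at h3
    have h4 : t ≤ 1 - (1 - t) ^ (d + 1) := by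
      have := pow_le_pow_of_le_one (by linarith : 0 ≤ 1 - t) (by linarith) (by omega : 1 ≤ d + 1)
      linarith
    have h5 : ENNReal.ofReal t * μ (directionCone a t ∩ Metric.ball 0 1) ≤
        ENNReal.ofReal t * (ENNReal.ofReal (2 ^ (d + 1) * t ^ d) * μ (Metric.ball 0 1)) := by
      rw [← mul_assoc, ← ENNReal.ofReal_mul ht.le]
      refine (mul_le_mul_left (ENNReal.ofReal_le_ofReal h4) _).trans (h3.trans_eq ?_)
      congr 2
      ring
    exact (ENNReal.mul_le_mul_iff_right (by simpa using ht) ENNReal.ofReal_ne_top).1 h5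
  · refine (measure_mono Set.inter_subset_right).trans (le_mul_of_one_le_left' ?_)
    rw [ENNReal.one_le_ofReal]
    exact one_le_mul_of_one_le_of_one_le (one_le_pow₀ one_le_two) (one_le_pow₀ ht1.le)

end Cone

namespace KleinBall

/-- The points whose direction is close to `a`, relative to the scale `ℓ` and to the depth below
the sphere at infinity. -/
def cusp {n : ℕ} (K : ℝ) (a : EuclideanSpace ℝ (Fin n)) (ℓ : ℝ) : Set (KleinBall n) :=
  {p | ‖‖p.1‖⁻¹ • p.1 - a‖ ≤ K * ℓ ∧ ‖‖p.1‖⁻¹ • p.1 - a‖ * ℓ ≤ K * (1 - ‖p.1‖)}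

/-- At depth about `4⁻ᵏ` the density is of order `2 ^ (k (d + 2))`, the thickness contributes `4⁻ᵏ`
and the cone `t ^ d`; the product is of order `(2ᵏ t) ^ d`. -/
theorem hvol_shell_le {d : ℕ} (a : EuclideanSpace ℝ (Fin (d + 1))) {t : ℝ} (ht : 0 < t) (k : ℕ) :
    hvol (d + 1) {p | p.1 ∈ directionCone a t ∩
        {p | (1 / 2 : ℝ) ^ (2 * (k + 1)) < 1 - ‖p‖ ∧ 1 - ‖p‖ ≤ (1 / 2) ^ (2 * k)}} ≤
      ENNReal.ofReal (2 ^ (d + 2) * (d + 1) * 2 ^ (d + 1) * (2 ^ k * t) ^ d) *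
        volume (Metric.ball (0 : EuclideanSpace ℝ (Fin (d + 1))) 1) := by
  have hs0 : (0 : ℝ) < (1 / 2) ^ (2 * k) := by positivity
  have hs1 : ((1 : ℝ) / 2) ^ (2 * k) ≤ 1 := pow_le_one₀ (by norm_num) (by norm_num)
  have hmeas : MeasurableSet (directionCone a t ∩
      {p | (1 / 2 : ℝ) ^ (2 * (k + 1)) < 1 - ‖p‖ ∧ 1 - ‖p‖ ≤ (1 / 2) ^ (2 * k)}) := by
    refine (measurableSet_directionCone a t).inter (MeasurableSet.inter ?_ ?_)
    · exact measurableSet_lt measurable_const (measurable_const.sub measurable_norm)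
    · exact measurableSet_le (measurable_const.sub measurable_norm) measurable_const
  refine (hvol_preimage_le (K := 2 ^ ((k + 1) * (d + 2))) hmeas ?_).trans ?_
  · rintro p ⟨-, hp, -⟩ hp1
    have h1 : (1 / 2 : ℝ) ^ (2 * (k + 1)) ≤ 1 - ‖p‖ ^ 2 := by nlinarith [norm_nonneg p]
    have h2 : (1 / 2 : ℝ) ^ (k + 1) ≤ √(1 - ‖p‖ ^ 2) := by
      refine Real.le_sqrt_of_sq_le ?_
      rwa [← pow_mul, mul_comm]
    rw [rpow_half_natCast_succ (le_trans (by positivity) h1)]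
    have h3 := pow_le_pow_left₀ (by positivity) h2 (d + 1 + 1)
    rw [← pow_mul, one_div_pow] at h3
    rw [one_div_le (lt_of_lt_of_le (by positivity) h3) (by positivity)]
    exact h3
  · have hsub : directionCone a t ∩
        {p | (1 / 2 : ℝ) ^ (2 * (k + 1)) < 1 - ‖p‖ ∧ 1 - ‖p‖ ≤ (1 / 2) ^ (2 * k)} ∩
          Metric.ball 0 1 ⊆
        directionCone a t ∩ {p | 1 - (1 / 2 : ℝ) ^ (2 * k) ≤ ‖p‖} ∩ Metric.ball 0 1 := by
      rintro p ⟨⟨h1, -, h2⟩, h3⟩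
      exact ⟨⟨h1, by simp only [Set.mem_ofPred_eq]; linarith⟩, h3⟩
    have hrank : Module.finrank ℝ (EuclideanSpace ℝ (Fin (d + 1))) = d + 1 := by simp
    have h1 := measure_mono (μ := volume) hsub
    rw [measure_cone_shell volume a t hs0.le hs1 (by omega), hrank] at h1
    have hbern : 1 - (1 - (1 / 2 : ℝ) ^ (2 * k)) ^ (d + 1) ≤ (d + 1) * (1 / 2) ^ (2 * k) := by
      have := one_add_mul_le_pow (a := -(1 / 2 : ℝ) ^ (2 * k)) (by linarith) (d + 1)
      push_cast at this
      rw [sub_eq_add_neg 1 ((1 / 2 : ℝ) ^ (2 * k))]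
      linarith
    refine (mul_le_mul_right (h1.trans (mul_le_mul' (ENNReal.ofReal_le_ofReal hbern)
      (measure_directionCone_le volume hrank a ht))) _).trans (le_of_eq ?_)
    rw [← mul_assoc, ← mul_assoc, ← ENNReal.ofReal_mul (by positivity),
      ← ENNReal.ofReal_mul (by positivity)]
    congr 2
    have e1 : (2 : ℝ) ^ ((k + 1) * (d + 2)) = 2 ^ (k * d) * 2 ^ (2 * k) * 2 ^ (d + 2) := by
      rw [← pow_add, ← pow_add]; congr 1; ring
    have e2 : (2 : ℝ) ^ (2 * k) * (1 / 2) ^ (2 * k) = 1 := by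
      rw [← mul_pow]; norm_num
    rw [e1, mul_pow (2 ^ k) t d, ← pow_mul]
    linear_combination (2 ^ (k * d) * 2 ^ (d + 2) * (d + 1) * (2 ^ (d + 1) * t ^ d)) * e2

theorem cusp_subset_iUnion {n : ℕ} {K : ℝ} (hK : 0 ≤ K) {a : EuclideanSpace ℝ (Fin n)} {ℓ : ℝ}
    (hℓ : 0 < ℓ) :
    cusp K a ℓ ⊆ ⋃ k : ℕ, {p | p.1 ∈ directionCone a (K * min ℓ ((1 / 2) ^ (2 * k) / ℓ)) ∩
        {p | (1 / 2 : ℝ) ^ (2 * (k + 1)) < 1 - ‖p‖ ∧ 1 - ‖p‖ ≤ (1 / 2) ^ (2 * k)}} := by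
  rintro p ⟨h1, h2⟩
  obtain ⟨k, hk1, hk2⟩ := exists_nat_pow_near_of_lt_one (x := 1 - ‖p.1‖) (y := (1 / 2 : ℝ) ^ 2)
    (by linarith [p.2]) (by linarith [norm_nonneg p.1]) (by norm_num) (by norm_num)
  rw [← pow_mul] at hk1 hk2
  refine Set.mem_iUnion.2 ⟨k, ?_, hk1, hk2⟩
  rw [mul_min_of_nonneg _ _ hK]
  refine le_min h1 ?_
  rw [← mul_div_assoc, le_div_iff₀ hℓ]
  exact h2.trans (mul_le_mul_of_nonneg_left hk2 hK)

/-- The volume of the cusp regions is bounded, uniformly in the scale. -/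
theorem exists_hvol_cusp_le {n : ℕ} (hn : 2 ≤ n) {K : ℝ} (hK : 0 < K) :
    ∃ C : ℝ≥0, ∀ (a : EuclideanSpace ℝ (Fin n)) (ℓ : ℝ), 0 < ℓ → hvol n (cusp K a ℓ) ≤ C := by
  obtain ⟨d, rfl⟩ : ∃ d, n = d + 1 := ⟨n - 1, by omega⟩
  have hω : volume (Metric.ball (0 : EuclideanSpace ℝ (Fin (d + 1))) 1) ≠ ∞ :=
    measure_ball_lt_top.ne
  set ω := volume (Metric.ball (0 : EuclideanSpace ℝ (Fin (d + 1))) 1)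
  set B : ℝ := 2 ^ (d + 2) * (d + 1) * 2 ^ (d + 1) * K ^ d with hB
  have hB0 : 0 < B := by positivity
  refine ⟨(ENNReal.ofReal (B * 4) * ω).toNNReal, fun a ℓ hℓ => ?_⟩
  rw [ENNReal.coe_toNNReal (ENNReal.mul_ne_top ENNReal.ofReal_ne_top hω)]
  have hterm : ∀ k : ℕ, hvol (d + 1) {p | p.1 ∈
      directionCone a (K * min ℓ ((1 / 2) ^ (2 * k) / ℓ)) ∩
        {p | (1 / 2 : ℝ) ^ (2 * (k + 1)) < 1 - ‖p‖ ∧ 1 - ‖p‖ ≤ (1 / 2) ^ (2 * k)}} ≤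
      ENNReal.ofReal (B * min (2 ^ k * ℓ) (1 / (2 ^ k * ℓ))) * ω := by
    intro k
    refine (hvol_shell_le a (by positivity) k).trans
      (mul_le_mul_left (ENNReal.ofReal_le_ofReal ?_) _)
    have e : 2 ^ k * (K * min ℓ ((1 / 2) ^ (2 * k) / ℓ)) =
        K * min (2 ^ k * ℓ) (1 / (2 ^ k * ℓ)) := by
      rw [mul_left_comm, mul_min_of_nonneg _ _ (by positivity : (0 : ℝ) ≤ 2 ^ k)]
      congr 2
      rw [mul_comm 2 k, pow_mul, one_div_pow, sq]
      field_simp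
    have hm0 : 0 ≤ min (2 ^ k * ℓ) (1 / (2 ^ k * ℓ)) := by positivity
    have hm1 : min (2 ^ k * ℓ) (1 / (2 ^ k * ℓ)) ≤ 1 := by
      rcases le_total (2 ^ k * ℓ) 1 with h | h
      · exact (min_le_left _ _).trans h
      · exact (min_le_right _ _).trans ((div_le_one (by positivity)).2 h)
    -- Dimension at least two enters here: for `d ≥ 1` the `d`-th power is dominated by the first,
    -- which is summable over the shells.
    have hpow := pow_le_of_le_one hm0 hm1 (by omega : d ≠ 0)
    rw [e, mul_pow, hB, ← mul_assoc]
    exact mul_le_mul_of_nonneg_left hpow (by positivity)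
  calc hvol (d + 1) (cusp K a ℓ) ≤ ∑' k : ℕ,
        ENNReal.ofReal (B * min (2 ^ k * ℓ) (1 / (2 ^ k * ℓ))) * ω :=
      (measure_mono (cusp_subset_iUnion hK.le hℓ)).trans
        ((measure_iUnion_le _).trans (ENNReal.tsum_le_tsum hterm))
    _ = (∑' k : ℕ, ENNReal.ofReal (B * min (2 ^ k * ℓ) (1 / (2 ^ k * ℓ)))) * ω :=
      ENNReal.tsum_mul_right
    _ ≤ ENNReal.ofReal (B * 4) * ω := by
      refine mul_le_mul_left (ENNReal.tsum_le_of_sum_range_le fun N => ?_) _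
      rw [← ENNReal.ofReal_sum_of_nonneg fun _ _ => by positivity, ← Finset.mul_sum]
      exact ENNReal.ofReal_le_ofReal (mul_le_mul_of_nonneg_left (sum_min_two_pow_le N hℓ) hB0.le)

/-- The hyperbolic convex hull of `N` points at infinity has volume `O(N)`. -/
theorem exists_hvol_convexHull_le {n : ℕ} (hn : 2 ≤ n) :
    ∃ C : ℝ≥0, ∀ Y : Finset (EuclideanSpace ℝ (Fin n)), (∀ y ∈ Y, ‖y‖ = 1) →
      hvol n {p | p.1 ∈ convexHull ℝ (insert 0 (Y : Set (EuclideanSpace ℝ (Fin n))))} ≤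
        C * Y.card := by
  obtain ⟨M, hM⟩ := exists_cusp_cover (EuclideanSpace ℝ (Fin n))
  obtain ⟨C, hC⟩ := exists_hvol_cusp_le hn (by norm_num : (0 : ℝ) < 384)
  have : NeZero n := ⟨by omega⟩
  have hzero : hvol n {p | p.1 ∈ ({0} : Set (EuclideanSpace ℝ (Fin n)))} = 0 := by
    refine le_antisymm ((hvol_preimage_le (K := 1) (measurableSet_singleton 0) ?_).trans ?_) bot_le
    · rintro x rfl -
      simp
    · rw [measure_mono_null Set.inter_subset_left (measure_singleton 0), mul_zero]
  refine ⟨C * M, fun Y hY => ?_⟩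
  rcases Y.eq_empty_or_nonempty with rfl | hne
  · simpa using hzero.le
  obtain ⟨P, hPc, hPpos, hPcov⟩ := hM Y hne hY
  have hsub : {p : KleinBall n | p.1 ∈ convexHull ℝ (insert 0 (Y : Set (EuclideanSpace ℝ (Fin n))))}
      ⊆ {p | p.1 ∈ ({0} : Set (EuclideanSpace ℝ (Fin n)))} ∪ ⋃ q ∈ P, cusp 384 q.1 q.2 := by
    intro p hp
    by_cases hp0 : p.1 = 0
    · exact Or.inl hp0
    · obtain ⟨q, hq, h⟩ := hPcov p.1 hp hp0 p.2
      exact Or.inr (Set.mem_iUnion₂.2 ⟨q, hq, h⟩)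
  calc _ ≤ hvol n (⋃ q ∈ P, cusp 384 q.1 q.2) := by
        refine (measure_mono hsub).trans ((measure_union_le _ _).trans ?_)
        rw [hzero, zero_add]
    _ ≤ ∑ q ∈ P, hvol n (cusp 384 q.1 q.2) := measure_biUnion_finset_le _ _
    _ ≤ ∑ _q ∈ P, (C : ℝ≥0∞) := Finset.sum_le_sum fun q hq => hC _ _ (hPpos q hq).2
    _ = P.card * C := by simp
    _ ≤ ((M * Y.card : ℕ) : ℝ≥0∞) * C := by gcongr
    _ = _ := by push_cast; ring

end KleinBall

/-! ### Enclosing a hyperbolic ball in the hull of few ideal points. -/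

section IdealHull

variable {E : Type*} [NormedAddCommGroup E] [InnerProductSpace ℝ E]

theorem exists_unit_tilt {ζ b : E} (hζ : ‖ζ‖ = 1) (hb : inner ℝ b ζ = 0) {t : ℝ} (ht : 0 ≤ t)
    (ht1 : t ≤ 1) : ∃ u : E, ‖u‖ = 1 ∧ ‖u - ζ‖ ≤ 2 * t ∧ ‖b‖ * t ≤ inner ℝ b u := by
  rcases eq_or_ne b 0 with rfl | hb0
  · exact ⟨ζ, hζ, by simpa using ht, by simp⟩
  have hbn := norm_pos_iff.2 hb0
  set e := ‖b‖⁻¹ • b with he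
  have hen : ‖e‖ = 1 := by rw [he, norm_smul, norm_inv, norm_norm, inv_mul_cancel₀ hbn.ne']
  have heζ : inner ℝ e ζ = 0 := by rw [he, real_inner_smul_left, hb, mul_zero]
  have hbe : inner ℝ b e = ‖b‖ := by
    rw [he, real_inner_smul_right, real_inner_self_eq_norm_sq]
    field_simp
  have ht2 : 0 ≤ 1 - t ^ 2 := by nlinarith
  have hs := Real.sq_sqrt ht2
  have hs0 := Real.sqrt_nonneg (1 - t ^ 2)
  set c := √(1 - t ^ 2)
  have hnorm : ∀ p q : ℝ, ‖p • ζ + q • e‖ ^ 2 = p ^ 2 + q ^ 2 := fun p q => by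
    rw [norm_add_sq_real, real_inner_smul_left, real_inner_smul_right, real_inner_comm, heζ,
      norm_smul, norm_smul, hζ, hen]
    simp
  refine ⟨c • ζ + t • e, ?_, ?_, ?_⟩
  · have := hnorm c t
    rw [hs] at this
    exact (sq_eq_sq₀ (norm_nonneg _) zero_le_one).1 (by linarith)
  · have e1 : c • ζ + t • e - ζ = (c - 1) • ζ + t • e := by module
    rw [e1]
    refine (sq_le_sq₀ (norm_nonneg _) (by positivity)).1 ?_
    rw [hnorm]
    nlinarith
  · rw [inner_add_right, real_inner_smul_right, real_inner_smul_right, hb, hbe]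
    linarith

/-- A functional separating `z` from the hull has normal `v = α ζ + b` with `α > 0` and `b`
orthogonal to `ζ = z / ‖z‖`. Tilting `ζ` towards `b` gains `‖b‖ t`, which pays for the error `t` of
the net. The resulting `f` has `⟨b, f⟩ ≥ 0` and lies within `3t` of `ζ`, so `⟨ζ, f⟩ ≥ 1 - 9t²/2 ≥
‖z‖`, and `f` is not separated from `z`. -/
theorem mem_convexHull_of_net [CompleteSpace E] {F : Finset E} (hF : ∀ f ∈ F, ‖f‖ = 1) {z : E}
    {t : ℝ} (ht : 0 ≤ t) (ht1 : t ≤ 1) (hz : ‖z‖ ≤ 1 - 9 * t ^ 2 / 2)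
    (hnet : ∀ u : E, ‖u‖ = 1 → ‖u - ‖z‖⁻¹ • z‖ ≤ 2 * t → ∃ f ∈ F, ‖f - u‖ ≤ t) :
    z ∈ convexHull ℝ (insert 0 (F : Set E)) := by
  by_contra hzF
  obtain ⟨g, w, hg, hgz⟩ := geometric_hahn_banach_closed_point (convex_convexHull ℝ _)
    ((F.finite_toSet.insert 0).isClosed_convexHull ℝ) hzF
  have hg0 := hg 0 (subset_convexHull ℝ _ (Set.mem_insert _ _))
  rw [map_zero] at hg0
  have hgF : ∀ f ∈ F, g f < g z := fun f hf =>
    (hg f (subset_convexHull ℝ _ (Set.mem_insert_of_mem _ (by simpa using hf)))).trans hgz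
  have hz0 : z ≠ 0 := by
    rintro rfl
    rw [map_zero] at hgz
    linarith
  have hzn := norm_pos_iff.2 hz0
  set ζ := ‖z‖⁻¹ • z with hζdef
  have hζ : ‖ζ‖ = 1 := by rw [hζdef, norm_smul, norm_inv, norm_norm, inv_mul_cancel₀ hzn.ne']
  set v := (InnerProductSpace.toDual ℝ E).symm g with hv
  have hgv : ∀ y, g y = inner ℝ v y := fun y => by rw [hv, InnerProductSpace.toDual_symm_apply]
  have hα : g z = ‖z‖ * inner ℝ v ζ := by
    rw [hgv, hζdef, real_inner_smul_right]
    field_simp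
  have hα0 : 0 < inner ℝ v ζ := pos_of_mul_pos_right (by rw [← hα]; linarith) hzn.le
  set b := v - (inner ℝ v ζ) • ζ with hb
  have hbζ : inner ℝ b ζ = 0 := by
    rw [hb, inner_sub_left, real_inner_smul_left, real_inner_self_eq_norm_sq, hζ]
    ring
  obtain ⟨u, hu, huζ, hbu⟩ := exists_unit_tilt hζ hbζ ht ht1
  obtain ⟨f, hf, hfu⟩ := hnet u hu huζ
  have hlt := hgF f hf
  have hvf : g f = inner ℝ v ζ * inner ℝ ζ f + inner ℝ b f := by
    rw [hgv, hb, inner_sub_left, real_inner_smul_left ζ f]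
    ring
  have h1 : 0 ≤ inner ℝ b f := by
    have h2 : inner ℝ b f = inner ℝ b u + inner ℝ b (f - u) := by rw [inner_sub_right]; ring
    have h3 := abs_le.1 (abs_real_inner_le_norm b (f - u))
    nlinarith [norm_nonneg b]
  have h2 : 1 - 9 * t ^ 2 / 2 ≤ inner ℝ ζ f := by
    have h3 : ‖f - ζ‖ ≤ 3 * t := by
      linarith [norm_sub_le_norm_sub_add_norm_sub f u ζ]
    have h4 := pow_le_pow_left₀ (norm_nonneg _) h3 2
    rw [norm_sub_sq_real, hF f hf, hζ, real_inner_comm] at h4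
    linarith
  nlinarith

end IdealHull

namespace KleinBall

variable {n : ℕ}

/-- Both depths are at most `1 - ⟨x, z⟩`, whose square is at most `4κ²` times their product. Thus a
ball of fixed radius has comparable depths throughout and Euclidean size of the order of the square
root of the depth. -/
theorem depth_comparison {x z : KleinBall n} {κ : ℝ} (hκ : 1 ≤ κ) (h : hcosh x z ≤ κ) :
    1 - ‖x.1‖ ≤ 4 * κ ^ 2 * (1 - ‖z.1‖) ∧ 1 - ‖z.1‖ ≤ 4 * κ ^ 2 * (1 - ‖x.1‖) ∧
      ‖x.1 - z.1‖ ^ 2 ≤ 8 * κ ^ 2 * (1 - ‖x.1‖) := by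
  have hx : 0 < 1 - ‖x.1‖ := by linarith [x.2]
  have hz : 0 < 1 - ‖z.1‖ := by linarith [z.2]
  have hxn := norm_nonneg x.1
  have hzn := norm_nonneg z.1
  have hin := real_inner_le_norm x.1 z.1
  have hsq : (1 - inner ℝ x.1 z.1) ^ 2 ≤ 4 * κ ^ 2 * ((1 - ‖x.1‖) * (1 - ‖z.1‖)) := by
    have hDx := one_sub_norm_sq_pos x
    have hDz := one_sub_norm_sq_pos z
    rw [one_sub_inner_eq, mul_pow, mul_pow, Real.sq_sqrt hDx.le, Real.sq_sqrt hDz.le]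
    have h1 : hcosh x z ^ 2 ≤ κ ^ 2 :=
      pow_le_pow_left₀ (zero_le_one.trans (one_le_hcosh x z)) h 2
    have h2 : 1 - ‖x.1‖ ^ 2 ≤ 2 * (1 - ‖x.1‖) := by nlinarith
    have h3 : 1 - ‖z.1‖ ^ 2 ≤ 2 * (1 - ‖z.1‖) := by nlinarith
    calc _ ≤ κ ^ 2 * ((2 * (1 - ‖x.1‖)) * (2 * (1 - ‖z.1‖))) := by gcongr
      _ = _ := by ring
  have hgx : 1 - ‖x.1‖ ≤ 1 - inner ℝ x.1 z.1 := by nlinarith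
  have hgz : 1 - ‖z.1‖ ≤ 1 - inner ℝ x.1 z.1 := by nlinarith
  have h1 : 1 - ‖x.1‖ ≤ 4 * κ ^ 2 * (1 - ‖z.1‖) := by
    have := (pow_le_pow_left₀ hx.le hgx 2).trans hsq
    refine le_of_mul_le_mul_left ?_ hx
    linarith
  have h2 : 1 - ‖z.1‖ ≤ 4 * κ ^ 2 * (1 - ‖x.1‖) := by
    have := (pow_le_pow_left₀ hz.le hgz 2).trans hsq
    refine le_of_mul_le_mul_left ?_ hz
    linarith
  have h3 : 1 - inner ℝ x.1 z.1 ≤ 4 * κ ^ 2 * (1 - ‖x.1‖) := by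
    refine (sq_le_sq₀ (hx.le.trans hgx) (by positivity)).1 (hsq.trans ?_)
    calc 4 * κ ^ 2 * ((1 - ‖x.1‖) * (1 - ‖z.1‖))
        ≤ 4 * κ ^ 2 * ((1 - ‖x.1‖) * (4 * κ ^ 2 * (1 - ‖x.1‖))) := by gcongr
      _ = _ := by ring
  refine ⟨h1, h2, ?_⟩
  rw [norm_sub_sq_real]
  nlinarith

/-- A hyperbolic ball is contained in the convex hull of the origin and a bounded number of points
at infinity. -/
theorem exists_ideal_hull_hball (n : ℕ) (R : ℝ) (hR : 0 ≤ R) :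
    ∃ M : ℕ, ∀ x : KleinBall n, ∃ F : Finset (EuclideanSpace ℝ (Fin n)), F.card ≤ M ∧
      (∀ f ∈ F, ‖f‖ = 1) ∧
      ∀ z ∈ hball x R, z.1 ∈ convexHull ℝ (insert 0 (F : Set (EuclideanSpace ℝ (Fin n)))) := by
  set κ := Real.cosh R with hκdef
  have hκ : 1 ≤ κ := Real.one_le_cosh R
  -- The radius adds `2t` for the tilt, `4κ²w` from `z / ‖z‖` to `z` and `3κ²w` from `z` to `x`,
  -- where `w = 5κt`.
  obtain ⟨M, hM⟩ := exists_packing_bound (E := EuclideanSpace ℝ (Fin n)) (35 * κ ^ 3 + 2)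
  refine ⟨M, fun x => ?_⟩
  have hx : 0 < 1 - ‖x.1‖ := by linarith [x.2]
  have hx1 : 1 - ‖x.1‖ ≤ 1 := by linarith [norm_nonneg x.1]
  have hsq := Real.sq_sqrt hx.le
  have hs0 := Real.sqrt_pos.2 hx
  have hs1 : √(1 - ‖x.1‖) ≤ 1 := Real.sqrt_le_one.2 hx1
  set w := √(1 - ‖x.1‖) with hw
  -- With this mesh every `z` in the ball satisfies `1 - ‖z‖ ≥ 25t²/4 ≥ 9t²/2`, as the net criterion
  -- requires.
  set t := w / (5 * κ) with ht
  have ht0 : 0 < t := by positivity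
  have hwt : w = 5 * κ * t := by rw [ht]; field_simp
  obtain ⟨F, hFS, -, hFM, hFnet⟩ := exists_separated_net
    (close := fun u f : EuclideanSpace ℝ (Fin n) => dist u f < t)
    (fun u f h => by rwa [dist_comm]) (fun u => by simpa using ht0)
    (S := {u | ‖u‖ = 1 ∧ ‖u - x.1‖ ≤ (35 * κ ^ 3 + 2) * t}) (M := M) fun F hF hsep =>
      hM x.1 t ht0 F (fun f hf => mem_closedBall_iff_norm.2 (hF hf).2)
        fun u hu f hf huf => not_lt.1 (hsep hu hf huf)
  have hF1 : ∀ f ∈ F, ‖f‖ = 1 := fun f hf => (hFS (by simpa using hf)).1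
  refine ⟨F, hFM, hF1, fun z hz => ?_⟩
  obtain ⟨h1, h2, h3⟩ := depth_comparison hκ ((hdist_lt_iff hR).1 hz).le
  rw [← hsq] at h1 h2 h3
  have hκt : 25 * κ ^ 2 * t ^ 2 = w ^ 2 := by rw [hwt]; ring
  by_cases hz0 : z.1 = 0
  · rw [hz0]
    exact subset_convexHull ℝ _ (Set.mem_insert _ _)
  have hzn := norm_pos_iff.2 hz0
  refine mem_convexHull_of_net hF1 ht0.le ?_ ?_ fun u hu huz => ?_
  · rw [ht, div_le_one (by positivity)]
    linarith
  · have h4 : κ ^ 2 * (25 * t ^ 2) ≤ κ ^ 2 * (4 * (1 - ‖z.1‖)) := by linarith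
    have h5 := le_of_mul_le_mul_left h4 (by positivity)
    nlinarith [sq_nonneg t]
  · have hzx : ‖z.1 - x.1‖ ≤ 3 * κ * w := by
      rw [norm_sub_rev]
      refine (sq_le_sq₀ (norm_nonneg _) (by positivity)).1 ?_
      nlinarith [sq_nonneg (κ * w)]
    have hζz : ‖‖z.1‖⁻¹ • z.1 - z.1‖ = 1 - ‖z.1‖ := by
      have : ‖z.1‖⁻¹ • z.1 - z.1 = (‖z.1‖⁻¹ - 1) • z.1 := by module
      rw [this, norm_smul, Real.norm_of_nonneg (by
        rw [sub_nonneg]; exact (one_le_inv₀ hzn).2 z.2.le)]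
      field_simp
    have hux : ‖u - x.1‖ ≤ (35 * κ ^ 3 + 2) * t := by
      have h4 := norm_sub_le_norm_sub_add_norm_sub u (‖z.1‖⁻¹ • z.1) x.1
      have h5 := norm_sub_le_norm_sub_add_norm_sub (‖z.1‖⁻¹ • z.1) z.1 x.1
      have h6 : 4 * κ ^ 2 * w ^ 2 ≤ 4 * κ ^ 2 * w := by
        refine mul_le_mul_of_nonneg_left ?_ (by positivity)
        nlinarith
      have h7 : 3 * κ * w ≤ 3 * κ ^ 2 * w := by
        refine mul_le_mul_of_nonneg_right ?_ hs0.le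
        nlinarith
      have h8 : 7 * κ ^ 2 * w = 35 * κ ^ 3 * t := by rw [hwt]; ring
      linarith
    obtain ⟨f, hf, hfu⟩ := hFnet u ⟨hu, hux⟩
    exact ⟨f, hf, by rw [← dist_eq_norm, dist_comm]; exact hfu.le⟩

theorem measurableSet_hball (x : KleinBall n) (r : ℝ) : MeasurableSet (hball x r) := by
  refine measurableSet_lt ?_ measurable_const
  unfold hdist Real.arcosh
  fun_prop

theorem card_mul_le_hvol_extension {ε : ℝ} {v : ℝ≥0}
    (hv : ∀ x : KleinBall n, (v : ℝ≥0∞) ≤ hvol n (hball x (ε / 2))) (hε : 0 < ε)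
    {A : Set (KleinBall n)} {F : Finset (KleinBall n)} (hFA : ↑F ⊆ A)
    (hF : (F : Set (KleinBall n)).Pairwise fun x y => ¬ hdist x y < ε) :
    (F.card : ℝ≥0∞) * v ≤ hvol n (extension ε A) := by
  calc (F.card : ℝ≥0∞) * v = ∑ _x ∈ F, (v : ℝ≥0∞) := by simp
    _ ≤ ∑ x ∈ F, hvol n (hball x (ε / 2)) := Finset.sum_le_sum fun x _ => hv x
    _ = hvol n (⋃ x ∈ F, hball x (ε / 2)) := by
      refine (measure_biUnion_finset (fun x hx y hy hxy => ?_)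
        fun x _ => measurableSet_hball x _).symm
      refine Set.disjoint_left.2 fun z hzx hzy => hF hx hy hxy ?_
      have h1 : hdist x z < ε / 2 := hzx
      have h2 : hdist y z < ε / 2 := hzy
      have h3 := hdist_triangle x z y
      rw [hdist_comm z y] at h3
      linarith
    _ ≤ hvol n (extension ε A) := by
      refine measure_mono (Set.iUnion₂_subset fun x hx z hz => ?_)
      exact Set.mem_iUnion₂.2 ⟨x, hFA (by simpa using hx), lt_trans hz (half_lt_self hε)⟩

end KleinBall

/-! ### Assembly of the volume comparison. -/

theorem theorem2 (n : ℕ) (hn : 2 ≤ n) (ε : ℝ) (hε : 0 < ε) :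
    ∃ C : ℝ≥0, ∀ A : Set (KleinBall n), NullMeasurableSet A (KleinBall.hvol n) →
      KleinBall.hvol n (KleinBall.hull (KleinBall.extension ε A)) ≤
          C * KleinBall.hvol n (KleinBall.extension ε A) ∧
        (A.Nonempty → KleinBall.hvol n (KleinBall.extension ε A) < ∞ →
          KleinBall.hvol n (KleinBall.hull (KleinBall.extension ε A)) <
            C * KleinBall.hvol n (KleinBall.extension ε A)) := by
  classical
  obtain ⟨v, hv0, hv⟩ := KleinBall.exists_pos_le_hvol_hball (by omega : 1 ≤ n) (half_pos hε)
  obtain ⟨C₀, hC₀⟩ := KleinBall.exists_hvol_convexHull_le hn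
  obtain ⟨M, hM⟩ := KleinBall.exists_ideal_hull_hball n (2 * ε) (by positivity)
  choose G hGM hG1 hG using hM
  -- The summand `1` gives strictness when the volume is positive and finite, and keeps the constant
  -- nonzero so that its product with `∞` is `∞`.
  refine ⟨C₀ * M / v + 1, fun A _ => ?_⟩
  rcases eq_or_ne (KleinBall.hvol n (KleinBall.extension ε A)) ∞ with htop | htop
  · rw [htop]
    refine ⟨?_, fun _ h => (lt_irrefl _ h).elim⟩
    rw [ENNReal.mul_top (by simp)]
    exact le_top
  set V := KleinBall.hvol n (KleinBall.extension ε A) with hV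
  have hcount : ∀ F : Finset (KleinBall n), ↑F ⊆ A →
      (F : Set (KleinBall n)).Pairwise (fun x y => ¬ KleinBall.hdist x y < ε) →
        (F.card : ℝ≥0∞) * v ≤ V :=
    fun F hFA hF => KleinBall.card_mul_le_hvol_extension hv hε hFA hF
  have hv0' : (v : ℝ≥0∞) ≠ 0 := by simpa using hv0.ne'
  obtain ⟨F, hFA, hFsep, -, hFnet⟩ := exists_separated_net
    (close := fun x y : KleinBall n => KleinBall.hdist x y < ε)
    (fun x y h => by rwa [KleinBall.hdist_comm]) (fun x => by rwa [KleinBall.hdist_self])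
    (S := A) (M := ⌊(V / v).toReal⌋₊) fun F hFA hF => by
      refine Nat.le_floor ?_
      rw [← ENNReal.toReal_natCast]
      refine ENNReal.toReal_mono (ENNReal.div_ne_top htop hv0') ?_
      rw [ENNReal.le_div_iff_mul_le (Or.inl hv0') (Or.inl ENNReal.coe_ne_top)]
      exact hcount F hFA hF
  have hNV : (F.card : ℝ≥0∞) ≤ V / v := by
    rw [ENNReal.le_div_iff_mul_le (Or.inl hv0') (Or.inl ENNReal.coe_ne_top)]
    exact hcount F hFA hFsep
  set Y := F.biUnion G with hY
  have hYcard : Y.card ≤ F.card * M := Finset.card_biUnion_le_card_mul _ _ _ fun x _ => hGM x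
  have hY1 : ∀ y ∈ Y, ‖y‖ = 1 := fun y hy => by
    obtain ⟨x, -, hyx⟩ := Finset.mem_biUnion.1 hy
    exact hG1 x y hyx
  have hsub : KleinBall.hull (KleinBall.extension ε A) ⊆
      {p | p.1 ∈ convexHull ℝ (insert 0 (Y : Set (EuclideanSpace ℝ (Fin n))))} := by
    refine KleinBall.hull_subset_of_convex (convex_convexHull ℝ _) fun z hz => ?_
    obtain ⟨a, ha, hza⟩ := Set.mem_iUnion₂.1 hz
    obtain ⟨x, hx, hax⟩ := hFnet a ha
    have hzx : z ∈ KleinBall.hball x (2 * ε) := by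
      have h1 : KleinBall.hdist a z < ε := hza
      have h2 := KleinBall.hdist_triangle x a z
      rw [KleinBall.hdist_comm x a] at h2
      change KleinBall.hdist x z < 2 * ε
      linarith
    refine convexHull_mono (Set.insert_subset_insert ?_) (hG x z hzx)
    exact_mod_cast Finset.subset_biUnion_of_mem G hx
  have hmain : KleinBall.hvol n (KleinBall.hull (KleinBall.extension ε A)) ≤
      ((C₀ * M / v : ℝ≥0) : ℝ≥0∞) * V := by
    calc _ ≤ (C₀ : ℝ≥0∞) * Y.card := (measure_mono hsub).trans (hC₀ Y hY1)
      _ ≤ C₀ * ((F.card * M : ℕ) : ℝ≥0∞) := by gcongr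
      _ = C₀ * (F.card * M) := by push_cast; rfl
      _ ≤ C₀ * (V / v * M) := by gcongr
      _ = _ := by
        rw [ENNReal.coe_div hv0.ne', ENNReal.coe_mul, ENNReal.coe_natCast, div_eq_mul_inv,
          div_eq_mul_inv]
        ring
  have hstep : ((C₀ * M / v + 1 : ℝ≥0) : ℝ≥0∞) * V = ((C₀ * M / v : ℝ≥0) : ℝ≥0∞) * V + V := by
    rw [ENNReal.coe_add, ENNReal.coe_one, add_mul, one_mul]
  rw [hstep]
  refine ⟨hmain.trans le_self_add, fun ⟨a, ha⟩ _ => ?_⟩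
  have hVpos : V ≠ 0 := by
    have := hcount {a} (by simpa using ha) (by simp)
    intro h
    rw [h] at this
    simp at this
    exact hv0.ne' this
  exact hmain.trans_lt (ENNReal.lt_add_right (ENNReal.mul_ne_top ENNReal.coe_ne_top htop) hVpos)
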